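/- **Setting.** Let $O_1,O_2,\dots$ be i.i.d. with law $P_0$, let $P_n$ be the empirical measure of $O_1,\dots,O_n$, and let $X=X(O)\in[0,1]^d$ be a measurable function of $O$; functions $f$ on $[0,1]^d$ are identified with $f(X(O))$ in $\|f\|_{1,P_0}$ and $\|f\|_{P_0}$, the $L^1(P_0)$ and $L^2(P_0)$ norms. Let $D^{(0)}([0,1]^d)$ be the càdlàg functions on $[0,1]^d$ with finite sectional variation norm, let $L(\psi)(O)$ be a loss with $P_0|L(\psi)|<\infty$ for $\psi\in D^{(0)}([0,1]^d)$, let $\psi_0\in D^{(0)}([0,1]^d)$ minimize $P_0L(\psi)$ over $D^{(0)}([0,1]^d)$, and let $d_0(\psi,\psi_0)=P_0L(\psi)-P_0L(\psi_0)$. Write $S_\theta(f)=\frac{d}{d\theta}L(\theta)(f)=\frac{d}{d\delta}L(\theta+\delta f)\big|_{\delta=0}$ for the score. Fix $k\ge 0$. On the linear span of the $k$-th order tensor product splines the pathwise derivative $S_\theta(f)(o)$ exists for all $\theta,f,o$ and is linear in $f$; for such $f$, $S_{\psi_0}(f)$ is $P_0$-integrable and the risk $P_0L(\psi_0+\delta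 f)$ may be differentiated at $\delta=0$ under the integral sign. For every $n\ge1$ let $\phi_1,\dots,\phi_N$ be $k$-th order splines and $x_1,\dots,x_m\in[0,1]^d$ design points (all may depend on the data), $H=(\phi_j(x_i))_{i,j}$, $W$ the positive semidefinite Gram matrix of the chosen inner product on $\mathbb R^m$, and $E$ a matrix with orthonormal columns that are eigenvectors of $H^\top WH$ with non-zero eigenvalues. Put $\tilde\phi_m=\sum_jE(j,m)\phi_j$, $\theta_{n,\alpha}=\sum_m\alpha(m)\tilde\phi_m$, $\beta(\alpha)(j)=\sum_m\alpha(m)E(j,m)$. The PC-HAGL (generalized lasso) estimator is $\theta_n=\theta_{n,\alpha_n}$, where $\alpha_n$ minimizes $P_nL(\theta_{n,\alpha})$ subject to $\|\beta(\alpha)\|_1\le C_n$, for an arbitrary data-dependent $C_n$. Let $\mathcal E(J_n)=\{m:\alpha_n(m)\ne0\}$, $J_n=|\mathcal E(J_n)|$. For $f=\sum_{m\in\mathcal E(J_n)}f(m)\tilde\phi_m\in D(\mathcal E(J_n))$ let $\beta(f)$ be $\beta$ of its coefficient vector, $\|f\|_2$ the Euclidean norm and $\langle\cdot,\cdot\rangle$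 the Euclidean inner product of coefficient vectors, and $D_M(\mathcal E(J_n))=\{f\in D(\mathcal E(J_n)):\|\beta(f)\|_1\le M\}$. For a subgradient $\ell$ of the $L_1$ norm at $\beta(\alpha_n)$ let $a_{1n}(m)=\sum_jE(j,m)\ell(j)$, $m\in\mathcal E(J_n)$, $f_{a_n}=\|a_{1n}\|_2^{-1}\sum_{m\in\mathcal E(J_n)}a_{1n}(m)\tilde\phi_m$ (and $f_{a_n}=0$ if $a_{1n}=0$, which happens only if $\alpha_n=0$), and $D_n(\mathcal E(J_n))=\{f\in D(\mathcal E(J_n)):\langle f,f_{a_n}\rangle=0\}$. **Theorem.** (i) For every $n\ge1$ and every sample there is a subgradient $\ell$ of the $L_1$ norm at $\beta(\alpha_n)$ such that $$P_nS_{\theta_n}(h)=0\quad\text{for all }h\in D_n(\mathcal E(J_n)).\tag{1}$$ If $\beta(\alpha_n)(j)\neq0$ for all $j$, then (1) holds with the only subgradient, $\ell(j)=\operatorname{sign}\beta(\alpha_n)(j)$. (ii) Let $\ell=\ell_n$ be any choice of subgradients for which (1) holds for all $n\ge 1$ and all samples. Let $0<M<\infty$ with $\Pr(\|\beta(\alpha_n)\|_1\le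 M)\to1$. Suppose that the score class $\{S_\theta(f):\theta,f\in D_M(\mathcal E(J_n))\}$ (the union over all $n\ge1$ and all realizations of the data-dependent sets $D_M(\mathcal E(J_n))$) satisfies the entropy bound of the class $D^{(k)}_M([0,1]^d)$ of functions with $k$-th order sectional variation norm at most $M$: the logarithm of its $L^2(P_0)$ bracketing number at $\varepsilon\in(0,1]$ is at most $K\varepsilon^{-1/(k+1)}(1+\log(1/\varepsilon))^q$ for some constants $K,q$. For a scale $\rho_n$ put $f^*_{a_n}=\rho_nf_{a_n}$, let $\tilde f_{a_n}$ be an $L^2(P_0)$ projection of $f^*_{a_n}$ on $D_n(\mathcal E(J_n))$, and consider the condition $(A_{\rho_n})$: $\|\beta(f^*_{a_n}-\tilde f_{a_n})\|_1=O_P(1)$; $\|S_{\theta_n}(f^*_{a_n}-\tilde f_{a_n})\|_{P_0}=o_P(1)$; and either $$\|\theta_n-\psi_0\|_\infty\,\|f^*_{a_n}-\tilde f_{a_n}\|_{1,P_0}=o_P(n^{-1/2}),$$ where the loss satisfies $|P_0\{S_\theta(g)-S_{\psi_0}(g)\}|\le K'\|\theta-\psi_0\|_\infty\|g\|_{1,P_0}$,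 or $$d_0^{1/2}(\theta_n,\psi_0)\,\|f^*_{a_n}-\tilde f_{a_n}\|_{P_0}=o_P(n^{-1/2}),$$ where the loss satisfies $|P_0\{S_\theta(g)-S_{\psi_0}(g)\}|\le K'd_0^{1/2}(\theta,\psi_0)\|g\|_{P_0}$; in both cases with a constant $K'$, for all linear combinations $\theta$ of $k$-th order splines whose coefficients have $L_1$ norm at most $M$ and all $g$ in the span of the $k$-th order splines. (a) If $(A_{\rho_n})$ holds with $\rho_n=J_n^{-1/2}$, then $$\sup_{f^*\in D_M(\mathcal E(J_n)),\ \|f^*\|_2\le J_n^{-1/2}}|P_nS_{\theta_n}(f^*)|=o_P(n^{-1/2}).\tag{2}$$ (b) If $(A_{\rho_n})$ holds with $\rho_n=n^{-1/2}$, then $\sup_{f^*\in D_M(\mathcal E(J_n)),\ \|f^*\|_2\le n^{-1/2}}|P_nS_{\theta_n}(f^*)|=o_P(n^{-1/2})$, and (2) holds as well if $n/J_n=O_P(1)$. (With $J_n^{-1/2}$ read as $0$ when $J_n=0$; $o_P$ and $O_P$ are in outer probability where measurability fails.) -/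

import Mathlib

open MeasureTheory ProbabilityTheory Filter Topology
open scoped ENNReal NNReal Nat

noncomputable section

namespace PCHA

/-! ### Functions on the unit cube -/

/-- The unit cube `[0,1]^d`. -/
abbrev Cube (d : ℕ) : Type := Fin d → unitInterval

/-- Multivariate càdlàg functions: right-continuous, with a limit from every quadrant. -/
def IsCadlag {d : ℕ} (f : Cube d → ℝ) : Prop :=
  (∀ x, ContinuousWithinAt f (Set.Ici x) x) ∧
  ∀ (x : Cube d) (s : Finset (Fin d)), ∃ l : ℝ,
    Tendsto f (𝓝[{y | ∀ i, (i ∈ s → y i < x i) ∧ (i ∉ s → x i ≤ y i)}] x) (𝓝 l)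

/-- The increment over one cell of a grid of the section `f_s(x(s)) = f(x(s), 0)`: the cell has
lower corner `a(s)` and upper corner `b(s)`. -/
def sectionIncrement {d : ℕ} (f : Cube d → ℝ) (s : Finset (Fin d)) (a b : Cube d) : ℝ :=
  ∑ t ∈ s.powerset, (-1 : ℝ) ^ (s \ t).card *
    f (fun i => if i ∈ t then b i else if i ∈ s then a i else 0)

/-- The variation norm of the section `f_s`: the supremum over all grids of the sum of the absolute
increments over the cells. For `s = ∅` it equals `|f(0)|`. -/
def sectionVariation {d : ℕ} (f : Cube d → ℝ) (s : Finset (Fin d)) : ℝ≥0∞ :=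
  ⨆ (n : ℕ) (u : Fin d → ℕ → unitInterval) (_ : ∀ i, Monotone (u i)),
    ∑ j ∈ Fintype.piFinset (fun i => if i ∈ s then Finset.range n else {0}),
      ENNReal.ofReal |sectionIncrement f s (fun i => u i (j i)) (fun i => u i (j i + 1))|

/-- The (zero-order) sectional variation norm `|f(0)| + ∑_{s ≠ ∅} ‖f_s‖_v`. -/
def sectionalVariationNorm {d : ℕ} (f : Cube d → ℝ) : ℝ≥0∞ :=
  ∑ s : Finset (Fin d), sectionVariation f s

/-- `D^{(0)}([0,1]^d)`: càdlàg functions with finite sectional variation norm. -/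
def D0 (d : ℕ) : Set (Cube d → ℝ) :=
  {f | IsCadlag f ∧ sectionalVariationNorm f < ⊤}

/-- One factor of a `k`-th order tensor product spline: the monomial `x^c / c!` for `c ≤ k`,
and the truncated power `1(x ≥ v) (x - v)^k / k!` for `c = k + 1`. -/
def splineFactor (k : ℕ) (c : Fin (k + 2)) (v x : ℝ) : ℝ :=
  if (c : ℕ) ≤ k then x ^ (c : ℕ) / ((c : ℕ)! : ℝ)
  else if v ≤ x then (x - v) ^ k / (k ! : ℝ) else 0

/-- The `k`-th order spline basis function with knot `v`. The nested sets
`s_{k+1} ⊆ ⋯ ⊆ s_1 ⊆ {1,…,d}` are coded by `c i = max {r | i ∈ s_r}` (`0` if `i ∉ s_1`). For `k = 0`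
these are the functions `x ↦ ∏_{i ∈ s} 1(x i ≥ v i)`. -/
def spline {d : ℕ} (k : ℕ) (c : Fin d → Fin (k + 2)) (v : Cube d) : Cube d → ℝ :=
  fun x => ∏ i, splineFactor k (c i) (v i) (x i)

/-- The linear span of all `k`-th order spline basis functions. -/
def splineSpan (d k : ℕ) : Submodule ℝ (Cube d → ℝ) :=
  Submodule.span ℝ (Set.range fun q : (Fin d → Fin (k + 2)) × Cube d => spline k q.1 q.2)

/-- Finite combinations `∑ β_j φ_j` of `k`-th order splines with `∑ |β_j| ≤ M`. -/
def splineBall (d k : ℕ) (M : ℝ) : Set (Cube d → ℝ) :=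
  {f | ∃ (N : ℕ) (c : Fin N → Fin d → Fin (k + 2)) (v : Fin N → Cube d) (β : Fin N → ℝ),
    ∑ j, |β j| ≤ M ∧ f = fun x => ∑ j, β j * spline k (c j) (v j) x}

/-- The supremum norm, with values in `[0,∞]`. -/
def supNorm {d : ℕ} (f : Cube d → ℝ) : ℝ≥0∞ := ⨆ x, ENNReal.ofReal |f x|

/-! ### Empirical means, losses and scores -/

/-- The empirical mean `P_n f` for the sample `o`. -/
def emp {𝒪 : Type*} {n : ℕ} (o : Fin n → 𝒪) (f : 𝒪 → ℝ) : ℝ := (n : ℝ)⁻¹ * ∑ i, f (o i)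

/-- The score `(d/dθ) L(θ)(f)`: the pathwise derivative of the loss at `θ` in the direction `f`. -/
def score {𝒪 : Type*} {d : ℕ} (L : (Cube d → ℝ) → 𝒪 → ℝ) (θ f : Cube d → ℝ) : 𝒪 → ℝ :=
  fun o => deriv (fun δ : ℝ => L (θ + δ • f) o) 0

/-- The loss is pathwise differentiable on the `k`-th order splines, and its derivative is linear in
the direction (homogeneity is automatic). -/
def PathwiseDifferentiable {𝒪 : Type*} {d : ℕ} (L : (Cube d → ℝ) → 𝒪 → ℝ) (k : ℕ) : Prop :=
  ∀ θ ∈ splineSpan d k, ∀ f ∈ splineSpan d k, ∀ o,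
    DifferentiableAt ℝ (fun δ : ℝ => L (θ + δ • f) o) 0 ∧
    ∀ g ∈ splineSpan d k, score L θ (f + g) o = score L θ f o + score L θ g o

/-- At `ψ₀` the risk may be differentiated under the integral sign in spline directions. -/
def RiskDifferentiableAt {𝒪 : Type*} [MeasurableSpace 𝒪] {d : ℕ} (L : (Cube d → ℝ) → 𝒪 → ℝ)
    (P0 : Measure 𝒪) (k : ℕ) (ψ₀ : Cube d → ℝ) : Prop :=
  ∀ f ∈ splineSpan d k, Integrable (score L ψ₀ f) P0 ∧
    HasDerivAt (fun δ : ℝ => ∫ o, L (ψ₀ + δ • f) o ∂P0) (∫ o, score L ψ₀ f o ∂P0) 0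

/-- `ψ₀` minimizes the true risk `P_0 L(ψ)` over `D^{(0)}([0,1]^d)`. -/
def IsRiskMinimizer {𝒪 : Type*} [MeasurableSpace 𝒪] {d : ℕ} (L : (Cube d → ℝ) → 𝒪 → ℝ)
    (P0 : Measure 𝒪) (ψ₀ : Cube d → ℝ) : Prop :=
  ψ₀ ∈ D0 d ∧ ∀ ψ ∈ D0 d, ∫ o, L ψ₀ o ∂P0 ≤ ∫ o, L ψ o ∂P0

/-- The loss-based dissimilarity `d_0(ψ, ψ₀) = P_0 L(ψ) - P_0 L(ψ₀)`. -/
def dissimilarity {𝒪 : Type*} [MeasurableSpace 𝒪] {d : ℕ} (L : (Cube d → ℝ) → 𝒪 → ℝ)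
    (P0 : Measure 𝒪) (ψ ψ₀ : Cube d → ℝ) : ℝ :=
  (∫ o, L ψ o ∂P0) - ∫ o, L ψ₀ o ∂P0

/-- `|P_0 {S_θ(g) - S_{ψ₀}(g)}| ≤ K ‖θ - ψ₀‖_∞ ‖g‖_{1,P_0}` for `θ ∈ D_M` and `g` a spline. -/
def ScoreDifferenceSupBound {𝒪 : Type*} [MeasurableSpace 𝒪] {d : ℕ}
    (L : (Cube d → ℝ) → 𝒪 → ℝ) (P0 : Measure 𝒪) (X : 𝒪 → Cube d) (ψ₀ : Cube d → ℝ)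
    (k : ℕ) (M : ℝ) : Prop :=
  ∃ K : ℝ≥0, ∀ θ ∈ splineBall d k M, ∀ g ∈ splineSpan d k,
    ENNReal.ofReal |(∫ o, score L θ g o ∂P0) - ∫ o, score L ψ₀ g o ∂P0| ≤
      K * supNorm (θ - ψ₀) * eLpNorm (fun o => g (X o)) 1 P0

/-- `|P_0 {S_θ(g) - S_{ψ₀}(g)}| ≤ K d_0(θ,ψ₀)^{1/2} ‖g‖_{P_0}` for `θ ∈ D_M` and `g` a spline. -/
def ScoreDifferenceL2Bound {𝒪 : Type*} [MeasurableSpace 𝒪] {d : ℕ}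
    (L : (Cube d → ℝ) → 𝒪 → ℝ) (P0 : Measure 𝒪) (X : 𝒪 → Cube d) (ψ₀ : Cube d → ℝ)
    (k : ℕ) (M : ℝ) : Prop :=
  ∃ K : ℝ≥0, ∀ θ ∈ splineBall d k M, ∀ g ∈ splineSpan d k,
    ENNReal.ofReal |(∫ o, score L θ g o ∂P0) - ∫ o, score L ψ₀ g o ∂P0| ≤
      K * ENNReal.ofReal (Real.sqrt (dissimilarity L P0 θ ψ₀)) *
        eLpNorm (fun o => g (X o)) 2 P0

/-! ### The PC working model and the PC-HAGL estimator -/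

/-- A working model and a fit: `N` spline basis functions `φ_j`, `m` design points `x_i`, the Gram
matrix `W` of the inner product `⟨·,·⟩_n` on `ℝ^m`, `p` eigenvectors (the columns of `E`), the
bound `C` and the coefficient vector `α`. -/
structure PCFit (d k : ℕ) where
  N : ℕ
  deg : Fin N → Fin d → Fin (k + 2)
  knot : Fin N → Cube d
  m : ℕ
  x : Fin m → Cube d
  W : Matrix (Fin m) (Fin m) ℝ
  p : ℕ
  E : Matrix (Fin N) (Fin p) ℝ
  C : ℝ
  α : Fin p → ℝ

namespace PCFit

variable {d k : ℕ} (F : PCFit d k)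

/-- The design matrix `H(i,j) = φ_j(x_i)`. -/
def H : Matrix (Fin F.m) (Fin F.N) ℝ :=
  Matrix.of fun i j => spline k (F.deg j) (F.knot j) (F.x i)

/-- The principal component basis function `φ̃_r = ∑_j E(j,r) φ_j`. -/
def pcBasis (r : Fin F.p) : Cube d → ℝ :=
  fun x => ∑ j, F.E j r * spline k (F.deg j) (F.knot j) x

/-- The function `∑_r h(r) φ̃_r` with coefficient vector `h`. -/
def fn (h : Fin F.p → ℝ) : Cube d → ℝ := fun x => ∑ r, h r * F.pcBasis r x

/-- The coefficient map `β(h)(j) = ∑_r h(r) E(j,r)`. -/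
def β (h : Fin F.p → ℝ) : Fin F.N → ℝ := fun j => ∑ r, h r * F.E j r

/-- `‖β(h)‖₁`. -/
def svn (h : Fin F.p → ℝ) : ℝ := ∑ j, |F.β h j|

/-- The fitted function `θ_n = θ_{n,α_n}`. -/
def θ : Cube d → ℝ := F.fn F.α

/-- The set `𝓔(J_n)` of active indices. -/
def active : Finset (Fin F.p) := Finset.univ.filter fun r => F.α r ≠ 0

/-- The number `J_n` of active indices. -/
def J : ℕ := F.active.card

/-- Coefficient vectors of the elements of `D(𝓔(J_n))`. -/
def Supported (h : Fin F.p → ℝ) : Prop := ∀ r, r ∉ F.active → h r = 0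

/-- Coefficient vectors of the elements of `D_M(𝓔(J_n))`. -/
def InBall (M : ℝ) (h : Fin F.p → ℝ) : Prop := F.Supported h ∧ F.svn h ≤ M

/-- The Euclidean norm of a coefficient vector. -/
def norm2 (h : Fin F.p → ℝ) : ℝ := Real.sqrt (∑ r, h r ^ 2)

/-- The columns of `E` are orthonormal eigenvectors of `HᵀWH` with non-zero eigenvalues. -/
def IsPC : Prop :=
  F.W.PosSemidef ∧ F.E.transpose * F.E = 1 ∧
  ∀ r, ∃ lam : ℝ, lam ≠ 0 ∧
    (F.H.transpose * F.W * F.H).mulVec (fun j => F.E j r) = lam • (fun j => F.E j r)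

/-- The fit is the PC-HAGL (generalized lasso) estimator for the sample `o`: `α` minimizes the
empirical risk `P_n L(θ_{n,α})` subject to `‖β(α)‖₁ ≤ C`. -/
def IsPCHAGL {𝒪 : Type*} {n : ℕ} (L : (Cube d → ℝ) → 𝒪 → ℝ) (o : Fin n → 𝒪) : Prop :=
  F.IsPC ∧ F.svn F.α ≤ F.C ∧
  ∀ α' : Fin F.p → ℝ, F.svn α' ≤ F.C → emp o (L (F.fn F.α)) ≤ emp o (L (F.fn α'))

/-- `ℓ` is a subgradient of the `L₁` norm on `ℝ^N` at `β(α_n)`. -/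
def IsSubgradient (ℓ : Fin F.N → ℝ) : Prop :=
  ∀ b : Fin F.N → ℝ, (∑ j, |F.β F.α j|) + ∑ j, ℓ j * (b j - F.β F.α j) ≤ ∑ j, |b j|

/-- The constraint gradient `a_{1n}(r) = ∑_j E(j,r) ℓ(j)`, `r ∈ 𝓔(J_n)` (zero elsewhere). -/
def a1 (ℓ : Fin F.N → ℝ) : Fin F.p → ℝ :=
  fun r => if r ∈ F.active then ∑ j, F.E j r * ℓ j else 0

/-- The coefficient vector of `f_{a_n} = ∑_r a_{1n}(r) φ̃_r / ‖a_{1n}‖₂`. -/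
def fa (ℓ : Fin F.N → ℝ) : Fin F.p → ℝ := fun r => F.a1 ℓ r / F.norm2 (F.a1 ℓ)

/-- Coefficient vectors of the elements of the tangent subspace
`D_n(𝓔(J_n)) = {f ∈ D(𝓔(J_n)) : ⟨f, f_{a_n}⟩ = 0}`. -/
def Tangent (ℓ : Fin F.N → ℝ) (h : Fin F.p → ℝ) : Prop :=
  F.Supported h ∧ ∑ r, h r * F.fa ℓ r = 0

/-- The score equations are solved exactly in every direction of the tangent subspace. -/
def SolvesTangentScores {𝒪 : Type*} {n : ℕ} (L : (Cube d → ℝ) → 𝒪 → ℝ) (o : Fin n → 𝒪)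
    (ℓ : Fin F.N → ℝ) : Prop :=
  ∀ h, F.Tangent ℓ h → emp o (score L F.θ (F.fn h)) = 0

/-- `b` is the coefficient vector of an `L²(P_0)` projection of `f` onto the tangent subspace. -/
def IsTangentProjection {𝒪 : Type*} [MeasurableSpace 𝒪] (P0 : Measure 𝒪) (X : 𝒪 → Cube d)
    (ℓ : Fin F.N → ℝ) (f : Cube d → ℝ) (b : Fin F.p → ℝ) : Prop :=
  F.Tangent ℓ b ∧ ∀ h, F.Tangent ℓ h →
    eLpNorm (fun o => f (X o) - F.fn b (X o)) 2 P0 ≤ eLpNorm (fun o => f (X o) - F.fn h (X o)) 2 P0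

/-- `sup |P_n (d/dθ_n) L(θ_n)(f*)|` over `f* ∈ D_M(𝓔(J_n))` with `‖f*‖₂ ≤ ρ`. -/
def supScore {𝒪 : Type*} {n : ℕ} (L : (Cube d → ℝ) → 𝒪 → ℝ) (o : Fin n → 𝒪) (M ρ : ℝ) : ℝ≥0∞ :=
  ⨆ (h : Fin F.p → ℝ) (_ : F.InBall M h ∧ F.norm2 h ≤ ρ),
    ENNReal.ofReal |emp o (score L F.θ (F.fn h))|

end PCFit

/-! ### Stochastic orders and entropy -/

/-- `Z_n = o_P(r_n)`; for non-measurable `Z_n` this is meant in outer probability. -/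
def LittleOP {Ω : Type*} [MeasurableSpace Ω] (P : Measure Ω) (Z : ℕ → Ω → ℝ≥0∞) (r : ℕ → ℝ) :
    Prop :=
  ∀ ε : ℝ, 0 < ε → Tendsto (fun n => P {ω | ENNReal.ofReal (ε * r n) < Z n ω}) atTop (𝓝 0)

/-- `Z_n = O_P(1)`; for non-measurable `Z_n` this is meant in outer probability. -/
def BigOPOne {Ω : Type*} [MeasurableSpace Ω] (P : Measure Ω) (Z : ℕ → Ω → ℝ≥0∞) : Prop :=
  ∀ η : ℝ≥0∞, 0 < η → ∃ B : ℝ≥0, ∀ᶠ n in atTop, P {ω | (B : ℝ≥0∞) < Z n ω} ≤ η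

/-- The first `n` observations. -/
def sample {Ω 𝒪 : Type*} (O : ℕ → Ω → 𝒪) (n : ℕ) (ω : Ω) : Fin n → 𝒪 := fun i => O i ω

/-- The entropy bound of `D^{(k)}_M([0,1]^d)`: up to powers of `log(1/ε)`, the logarithm of the
`L²(P_0)` bracketing number is of order `ε^{-1/(k+1)}`. -/
def EntropyBound {𝒪 : Type*} [MeasurableSpace 𝒪] (P0 : Measure 𝒪) (k : ℕ)
    (𝓕 : Set (𝒪 → ℝ)) : Prop :=
  ∃ (K : ℝ) (q : ℕ), ∀ ε : ℝ, 0 < ε → ε ≤ 1 →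
    ∃ B : Finset ((𝒪 → ℝ) × (𝒪 → ℝ)),
      Real.log (B.card : ℝ) ≤
        K * ε ^ (-(1 / ((k : ℝ) + 1))) * (1 + Real.log (1 / ε)) ^ q ∧
      (∀ b ∈ B, MemLp b.1 2 P0 ∧ MemLp b.2 2 P0 ∧
        eLpNorm (fun o => b.2 o - b.1 o) 2 P0 ≤ ENNReal.ofReal ε) ∧
      ∀ f ∈ 𝓕, ∃ b ∈ B, ∀ o, b.1 o ≤ f o ∧ f o ≤ b.2 o

/-- The class of scores `(d/dθ) L(θ)(f)` with `θ, f ∈ D_M(𝓔(J_n))`, over all sample sizes and all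
realizations of the (data-dependent) working model. -/
def scoreClass {𝒪 : Type*} {d k : ℕ} (L : (Cube d → ℝ) → 𝒪 → ℝ)
    (fit : ∀ n : ℕ, (Fin n → 𝒪) → PCFit d k) (M : ℝ) : Set (𝒪 → ℝ) :=
  {g | ∃ (n : ℕ) (o : Fin n → 𝒪) (t h : Fin (fit n o).p → ℝ), 1 ≤ n ∧
    (fit n o).InBall M t ∧ (fit n o).InBall M h ∧
    g = score L ((fit n o).fn t) ((fit n o).fn h)}

/-- The conditions on the unsolved direction, scaled by `ρ_n`: `f*_{a_n} = ρ_n f_{a_n}`, with `L²(P_0)`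
projection `f̃_{a_n}` onto the tangent subspace. The difference `f*_{a_n} - f̃_{a_n}` has
`‖β(·)‖₁ = O_P(1)`, its score tends to zero in `L²(P_0)`, and one of the two product conditions
holds, together with the matching bound for the score difference. -/
def ProjectionCondition {Ω 𝒪 : Type*} [MeasurableSpace Ω] [MeasurableSpace 𝒪] {d k : ℕ}
    (P : Measure Ω) (P0 : Measure 𝒪) (O : ℕ → Ω → 𝒪) (X : 𝒪 → Cube d)
    (L : (Cube d → ℝ) → 𝒪 → ℝ) (ψ₀ : Cube d → ℝ) (M : ℝ)
    (fit : ∀ n : ℕ, (Fin n → 𝒪) → PCFit d k)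
    (ℓ : ∀ (n : ℕ) (o : Fin n → 𝒪), Fin (fit n o).N → ℝ)
    (ρ : ∀ n : ℕ, (Fin n → 𝒪) → ℝ) : Prop :=
  ∃ b : ∀ (n : ℕ) (o : Fin n → 𝒪), Fin (fit n o).p → ℝ,
    (∀ n o, 1 ≤ n → (fit n o).IsTangentProjection P0 X (ℓ n o)
      ((fit n o).fn (ρ n o • (fit n o).fa (ℓ n o))) (b n o)) ∧
    let D : ∀ (n : ℕ) (o : Fin n → 𝒪), Fin (fit n o).p → ℝ :=
      fun n o => ρ n o • (fit n o).fa (ℓ n o) - b n o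
    let g : ∀ (n : ℕ), (Fin n → 𝒪) → Cube d → ℝ := fun n o => (fit n o).fn (D n o)
    BigOPOne P (fun n ω => ENNReal.ofReal
      ((fit n (sample O n ω)).svn (D n (sample O n ω)))) ∧
    LittleOP P (fun n ω => eLpNorm
      (score L (fit n (sample O n ω)).θ (g n (sample O n ω))) 2 P0) (fun _ => 1) ∧
    ((ScoreDifferenceSupBound L P0 X ψ₀ k M ∧
      LittleOP P (fun n ω => supNorm ((fit n (sample O n ω)).θ - ψ₀) *
        eLpNorm (fun z => g n (sample O n ω) (X z)) 1 P0) (fun n => 1 / Real.sqrt n)) ∨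
     (ScoreDifferenceL2Bound L P0 X ψ₀ k M ∧
      LittleOP P (fun n ω => ENNReal.ofReal
          (Real.sqrt (dissimilarity L P0 (fit n (sample O n ω)).θ ψ₀)) *
        eLpNorm (fun z => g n (sample O n ω) (X z)) 2 P0) (fun n => 1 / Real.sqrt n)))

end PCHA

end

/-!
The first part is the Lagrange multiplier rule for an `L₁` constraint. Pathwise differentiability
makes the empirical score at the fit a linear functional of the coefficient vector of the direction.
As the fit minimizes the empirical risk over an `L₁` ball, the negative of this functional is
maximized over the ball at the fit, and the Hahn–Banach theorem represents it as a multiple of a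
subgradient of the `L₁` norm (`exists_subgradient_of_isMax`). Tangent directions are those that the
subgradient annihilates.

For the second part, a supported direction `h` equals `⟨h, f_{a_n}⟩ f_{a_n}` up to a tangent
direction, so the supremum of the empirical scores is at most the absolute score in the single
direction `D_n = ρ_n f_{a_n} - f̃_{a_n}` (`SolvesTangentScores.supScore_le`). Its mean under `P_0` is
small by the product condition, because the population score vanishes at the risk minimizer `ψ₀`:
splines are càdlàg with finite sectional variation norm, so `ψ₀ + δ D_n` stays in the parameter
space. The centred part is `n^{-1/2}` times the empirical process at a member of the score class
(after rescaling) whose `L²(P_0)` norm tends to zero in probability, hence is `o_P(n^{-1/2})` once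
the empirical process over the score class is asymptotically equicontinuous
(`IsIIDSample.equicontinuous`).

Equicontinuity is Ossiander's bracketing theorem for entropy exponents below `2`, without an
envelope condition. Brackets of size `16^{-q}` are intersected along a chain, which makes their
widths decreasing in `q`. A link from level `q` to `q + 1` is kept only where all widths so far are
below truncation heights of order `√n 16^{-q} / 8^{q+1}`, so that Bernstein's inequality is in its
sub-Gaussian range; the first time a width exceeds its height contributes a mean that is bounded
through the second moment of the width. These contributions are of order `2^{-q}`. The parts cut off
at the initial level have vanishing first moment as `n → ∞`. All exceptional events are expressed
through the finitely many brackets, and the outer measure of the (possibly non-measurable) event of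
interest is bounded by monotonicity.
-/

noncomputable section

namespace PCHA

/-! ### Linearity of the score -/

section Score

variable {𝒪 : Type*} {d k : ℕ} {L : (Cube d → ℝ) → 𝒪 → ℝ}

lemma score_smul (θ f : Cube d → ℝ) (c : ℝ) (o : 𝒪) :
    score L θ (c • f) o = c * score L θ f o := by
  have h := deriv_comp_mul_left c (fun δ : ℝ => L (θ + δ • f) o) 0
  simp only [mul_zero, smul_eq_mul] at h
  rw [score, score, ← h]
  congr 1
  funext δ
  rw [smul_smul, mul_comm]

lemma score_add (hL : PathwiseDifferentiable L k) {θ f g : Cube d → ℝ} (hθ : θ ∈ splineSpan d k)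
    (hf : f ∈ splineSpan d k) (hg : g ∈ splineSpan d k) (o : 𝒪) :
    score L θ (f + g) o = score L θ f o + score L θ g o :=
  (hL θ hθ f hf o).2 g hg

lemma emp_add {n : ℕ} (o : Fin n → 𝒪) (f g : 𝒪 → ℝ) :
    emp o (fun z => f z + g z) = emp o f + emp o g := by
  simp [emp, Finset.sum_add_distrib, mul_add]

lemma emp_mul {n : ℕ} (o : Fin n → 𝒪) (c : ℝ) (f : 𝒪 → ℝ) :
    emp o (fun z => c * f z) = c * emp o f := by
  simp only [emp, ← Finset.mul_sum]; ring

lemma emp_mono {n : ℕ} {o : Fin n → 𝒪} {f g : 𝒪 → ℝ} (h : ∀ z, f z ≤ g z) : emp o f ≤ emp o g :=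
  mul_le_mul_of_nonneg_left (Finset.sum_le_sum fun _ _ => h _) (by positivity)

end Score

namespace PCFit

variable {d k : ℕ} (F : PCFit d k)

lemma pcBasis_mem (r : Fin F.p) : F.pcBasis r ∈ splineSpan d k := by
  have : F.pcBasis r = ∑ j, F.E j r • spline k (F.deg j) (F.knot j) := by
    funext x; simp [pcBasis]
  rw [this]
  exact Submodule.sum_mem _ fun j _ => Submodule.smul_mem _ _ (Submodule.subset_span ⟨(_, _), rfl⟩)

lemma fn_eq_sum (h : Fin F.p → ℝ) : F.fn h = ∑ r, h r • F.pcBasis r := by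
  funext x; simp [fn]

lemma fn_mem (h : Fin F.p → ℝ) : F.fn h ∈ splineSpan d k := by
  rw [fn_eq_sum]
  exact Submodule.sum_mem _ fun r _ => Submodule.smul_mem _ _ (F.pcBasis_mem r)

lemma fn_add (h g : Fin F.p → ℝ) : F.fn (h + g) = F.fn h + F.fn g := by
  simp [fn_eq_sum, add_smul, Finset.sum_add_distrib]

lemma fn_smul (c : ℝ) (h : Fin F.p → ℝ) : F.fn (c • h) = c • F.fn h := by
  simp [fn_eq_sum, Finset.smul_sum, smul_smul]

/-- The coefficient map `β` as a linear map. -/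
def betaLin : (Fin F.p → ℝ) →ₗ[ℝ] (Fin F.N → ℝ) where
  toFun := F.β
  map_add' h g := by funext j; simp [β, add_mul, Finset.sum_add_distrib]
  map_smul' c h := by funext j; simp [β, Finset.mul_sum, mul_assoc]

@[simp] lemma betaLin_apply (h : Fin F.p → ℝ) : F.betaLin h = F.β h := rfl

lemma svn_smul (c : ℝ) (h : Fin F.p → ℝ) : F.svn (c • h) = |c| * F.svn h := by
  have : F.β (c • h) = c • F.β h := F.betaLin.map_smul c h
  simp [svn, this, abs_mul, Finset.mul_sum]

lemma svn_nonneg (h : Fin F.p → ℝ) : 0 ≤ F.svn h := Finset.sum_nonneg fun _ _ => abs_nonneg _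

variable {F}

lemma IsPC.betaLin_injective (hF : F.IsPC) : Function.Injective F.betaLin := by
  have key : ∀ h : Fin F.p → ℝ, F.E.transpose.mulVec (F.β h) = h := fun h => by
    have : F.β h = F.E.mulVec h := by
      funext j; simp [β, Matrix.mulVec, dotProduct, mul_comm]
    rw [this, Matrix.mulVec_mulVec, hF.2.1, Matrix.one_mulVec]
  intro h g hg
  rw [← key h, ← key g]
  exact congrArg _ hg

/-- A fitted function `θ_{n,α}` is a spline combination with coefficient vector `β(α)`. -/
lemma fn_mem_splineBall {M : ℝ} {h : Fin F.p → ℝ} (hM : F.svn h ≤ M) :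
    F.fn h ∈ splineBall d k M := by
  refine ⟨F.N, F.deg, F.knot, F.β h, hM, ?_⟩
  funext x
  simp only [fn, pcBasis, β, Finset.mul_sum, Finset.sum_mul]
  rw [Finset.sum_comm]
  simp only [mul_assoc]

variable {𝒪 : Type*} {n : ℕ} {L : (Cube d → ℝ) → 𝒪 → ℝ}

/-- The empirical score at the fit, as a linear functional of the coefficient vector of the
direction. -/
def empScore (F : PCFit d k) (hL : PathwiseDifferentiable L k) (o : Fin n → 𝒪) :
    (Fin F.p → ℝ) →ₗ[ℝ] ℝ where
  toFun h := emp o (score L F.θ (F.fn h))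
  map_add' h g := by
    rw [← emp_add, fn_add]
    congr 1
    funext z
    exact score_add hL (F.fn_mem _) (F.fn_mem _) (F.fn_mem _) z
  map_smul' c h := by
    rw [RingHom.id_apply, smul_eq_mul, ← emp_mul, fn_smul]
    congr 1
    funext z
    exact score_smul _ _ _ z

lemma empScore_apply (hL : PathwiseDifferentiable L k) (o : Fin n → 𝒪) (h : Fin F.p → ℝ) :
    F.empScore hL o h = emp o (score L F.θ (F.fn h)) := rfl

/-- First-order optimality: the empirical score is nonnegative in every direction that points from
the fit into the `L₁` ball. -/
lemma IsPCHAGL.empScore_sub_nonneg {o : Fin n → 𝒪} (hF : F.IsPCHAGL L o)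
    (hL : PathwiseDifferentiable L k) {α' : Fin F.p → ℝ} (hα' : F.svn α' ≤ F.C) :
    F.empScore hL o F.α ≤ F.empScore hL o α' := by
  rw [← sub_nonneg, ← map_sub, empScore_apply]
  set v := α' - F.α with hv
  set R : ℝ → ℝ := fun δ => emp o (L (F.θ + δ • F.fn v)) with hR
  have hder : HasDerivAt R (emp o (score L F.θ (F.fn v))) 0 := by
    refine HasDerivAt.const_mul _ (HasDerivAt.fun_sum fun i _ => ?_)
    exact ((hL _ (F.fn_mem _) _ (F.fn_mem _) (o i)).1).hasDerivAt
  have hmin : ∀ δ ∈ Set.Icc (0 : ℝ) 1, R 0 ≤ R δ := by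
    intro δ hδ
    have h1 : F.θ + δ • F.fn v = F.fn (F.α + δ • v) := by rw [fn_add, fn_smul]; rfl
    have h2 : F.α + δ • v = (1 - δ) • F.α + δ • α' := by
      funext r; simp [hv]; ring
    have h3 : F.svn (F.α + δ • v) ≤ F.C := by
      have hb : F.β (F.α + δ • v) = (1 - δ) • F.β F.α + δ • F.β α' := by
        rw [h2]; exact (F.betaLin.map_add _ _).trans (by simp)
      have hle : F.svn (F.α + δ • v) ≤ (1 - δ) * F.svn F.α + δ * F.svn α' := by
        simp only [svn, hb, Finset.mul_sum, ← Finset.sum_add_distrib]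
        refine Finset.sum_le_sum fun j _ => (abs_add_le _ _).trans ?_
        simp [abs_mul, abs_of_nonneg hδ.1, abs_of_nonneg (sub_nonneg.2 hδ.2)]
      nlinarith [hF.2.1, hδ.1, hδ.2]
    simp only [hR, h1, zero_smul, add_zero]
    exact hF.2.2 _ h3
  have hlim := hder.hasDerivWithinAt (s := Set.Ici 0)
  have hlim' := hasDerivWithinAt_iff_tendsto_slope.1 hlim
  rw [show Set.Ici (0 : ℝ) \ {0} = Set.Ioi 0 by ext x; simp [lt_iff_le_and_ne, eq_comm]] at hlim'
  refine ge_of_tendsto hlim' ?_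
  filter_upwards [Ioc_mem_nhdsGT (show (0 : ℝ) < 1 by norm_num)] with δ hδ
  rw [slope_def_field]
  exact div_nonneg (sub_nonneg.2 (hmin δ ⟨hδ.1.le, hδ.2⟩)) (by simpa using hδ.1.le)

end PCFit

/-! ### Lagrange multipliers for the `L₁` constraint -/

lemma sum_sign_le_sum_abs {ι : Type*} [Fintype ι] (y b : ι → ℝ) :
    (∑ j, |y j|) + ∑ j, Real.sign (y j) * (b j - y j) ≤ ∑ j, |b j| := by
  rw [← Finset.sum_add_distrib]
  refine Finset.sum_le_sum fun j _ => ?_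
  rcases lt_trichotomy (y j) 0 with h | h | h
  · rw [Real.sign_of_neg h, abs_of_neg h]; linarith [neg_abs_le (b j)]
  · simp [h]
  · rw [Real.sign_of_pos h, abs_of_pos h]; linarith [le_abs_self (b j)]

/-- A linear functional that is maximized at `α` over an `L₁` ball of positive radius is a multiple
of a subgradient of the `L₁` norm. -/
lemma exists_subgradient_of_isMax {V ι : Type*} [AddCommGroup V] [Module ℝ V] [Fintype ι]
    (B : V →ₗ[ℝ] (ι → ℝ)) (hB : Function.Injective B) (G : V →ₗ[ℝ] ℝ) {C : ℝ} (hC : 0 < C) (α : V)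
    (hα : ∑ j, |B α j| ≤ C) (hmax : ∀ v, ∑ j, |B v j| ≤ C → G v ≤ G α) :
    ∃ (ℓ : ι → ℝ) (lam : ℝ),
      (∀ b : ι → ℝ, (∑ j, |B α j|) + ∑ j, ℓ j * (b j - B α j) ≤ ∑ j, |b j|) ∧
      ∀ v, G v = lam * ∑ j, ℓ j * B v j := by
  classical
  set lam := G α / C with hlam
  have hGα : 0 ≤ G α := by simpa using hmax 0 (by simpa using hC.le)
  have hlam0 : 0 ≤ lam := by positivity
  have hbound : ∀ v, G v ≤ lam * ∑ j, |B v j| := by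
    intro v
    rcases (Finset.sum_nonneg fun j (_ : j ∈ Finset.univ) => abs_nonneg (B v j)).eq_or_lt with h | h
    · have hv : v = 0 := hB <| by
        funext j
        simpa using (Finset.sum_eq_zero_iff_of_nonneg fun j _ => abs_nonneg (B v j)).1 h.symm j
          (Finset.mem_univ j)
      simp [hv]
    · have := hmax ((C / ∑ j, |B v j|) • v) (by
        simp only [map_smul, Pi.smul_apply, smul_eq_mul, abs_mul, ← Finset.mul_sum]
        rw [abs_of_pos (div_pos hC h), div_mul_cancel₀ _ h.ne'])
      rw [map_smul, smul_eq_mul, div_mul_eq_mul_div, div_le_iff₀ h] at this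
      rw [hlam, div_mul_eq_mul_div, le_div_iff₀ hC]
      linarith
  rcases hlam0.eq_or_lt with h0 | hpos
  · refine ⟨fun j => Real.sign (B α j), 0, fun b => sum_sign_le_sum_abs _ _, fun v => ?_⟩
    have h1 := hbound v
    have h2 := hbound (-v)
    rw [← h0, zero_mul] at h1 h2
    rw [map_neg] at h2
    linarith
  · let e := LinearEquiv.ofInjective B hB
    obtain ⟨g, hg1, hg2⟩ := exists_extension_of_le_sublinear
      ⟨LinearMap.range B, G ∘ₗ e.symm.toLinearMap⟩ (fun b => lam * ∑ j, |b j|)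
      (fun c hc b => by simp [abs_mul, abs_of_pos hc, ← Finset.mul_sum]; ring)
      (fun a b => by
        rw [← mul_add, ← Finset.sum_add_distrib]
        exact mul_le_mul_of_nonneg_left (Finset.sum_le_sum fun j _ => abs_add_le _ _) hlam0)
      (fun b => by
        obtain ⟨v, rfl⟩ := e.surjective b
        simpa [e] using hbound v)
    have hgB : ∀ v, g (B v) = G v := fun v => by
      have := hg1 (e v)
      simpa [e] using this
    have hgsum : ∀ b, g b = ∑ j, g (Pi.single j 1) * b j := fun b => by
      conv_lhs => rw [← Finset.univ_sum_single b]
      rw [map_sum]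
      refine Finset.sum_congr rfl fun j _ => ?_
      rw [mul_comm, ← smul_eq_mul, ← map_smul, ← Pi.single_smul, smul_eq_mul, mul_one]
    have hrep : ∀ b, ∑ j, g (Pi.single j 1) / lam * b j = g b / lam := fun b => by
      rw [hgsum b, Finset.sum_div]
      exact Finset.sum_congr rfl fun j _ => by ring
    refine ⟨fun j => g (Pi.single j 1) / lam, lam, fun b => ?_, fun v => ?_⟩
    · have h1 : g b / lam ≤ ∑ j, |b j| := by
        rw [div_le_iff₀ hpos, mul_comm]; exact hg2 b
      have h2 : g (B α) / lam = C := by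
        rw [hgB, hlam, div_div_cancel₀]
        rintro h; rw [hlam, h] at hpos; simp at hpos
      simp only [mul_sub, Finset.sum_sub_distrib, hrep, h2]
      linarith
    · rw [hrep, hgB, mul_div_cancel₀ _ hpos.ne']

/-- At a vector without zero coordinates the sign vector is the only subgradient of the `L₁` norm. -/
lemma eq_sign_of_subgradient {ι : Type*} [Fintype ι] {y ℓ : ι → ℝ} (hy : ∀ j, y j ≠ 0)
    (hℓ : ∀ b : ι → ℝ, (∑ j, |y j|) + ∑ j, ℓ j * (b j - y j) ≤ ∑ j, |b j|) :
    ℓ = fun j => Real.sign (y j) := by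
  classical
  funext j
  -- compare the norm at `y` with its values at `y` with coordinate `j` set to `0` or doubled
  have key : ∀ t : ℝ, |y j| + ℓ j * (t - y j) ≤ |t| := fun t => by
    have := hℓ (Function.update y j t)
    rw [← Finset.add_sum_erase _ _ (Finset.mem_univ j),
      ← Finset.add_sum_erase _ (fun i => ℓ i * _) (Finset.mem_univ j),
      ← Finset.add_sum_erase _ (fun i => |Function.update y j t i|) (Finset.mem_univ j)] at this
    have h1 : ∑ i ∈ Finset.univ.erase j, ℓ i * (Function.update y j t i - y i) = 0 :=
      Finset.sum_eq_zero fun i hi => by simp [Function.update_of_ne (Finset.ne_of_mem_erase hi)]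
    have h2 : ∑ i ∈ Finset.univ.erase j, |Function.update y j t i| =
        ∑ i ∈ Finset.univ.erase j, |y i| :=
      Finset.sum_congr rfl fun i hi => by rw [Function.update_of_ne (Finset.ne_of_mem_erase hi)]
    simp only [h1, h2, Function.update_self] at this
    linarith
  have h0 := key 0
  have h2 := key (2 * y j)
  rcases lt_or_gt_of_ne (hy j) with h | h
  · rw [Real.sign_of_neg h]
    rw [abs_of_neg h] at h0 h2
    rw [abs_of_neg (by linarith)] at h2
    simp only [abs_zero] at h0
    nlinarith
  · rw [Real.sign_of_pos h]
    rw [abs_of_pos h] at h0 h2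
    rw [abs_of_pos (by linarith)] at h2
    simp only [abs_zero] at h0
    nlinarith

namespace PCFit

variable {d k : ℕ} {F : PCFit d k}

lemma norm2_sq (h : Fin F.p → ℝ) : F.norm2 h ^ 2 = ∑ r, h r ^ 2 :=
  Real.sq_sqrt (Finset.sum_nonneg fun _ _ => sq_nonneg _)

lemma norm2_eq_zero {h : Fin F.p → ℝ} (h0 : F.norm2 h = 0) : h = 0 := by
  have := norm2_sq h
  rw [h0, zero_pow two_ne_zero] at this
  funext r
  simpa using (Finset.sum_eq_zero_iff_of_nonneg fun r _ => sq_nonneg (h r)).1 this.symm r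
    (Finset.mem_univ r)

/-- Tangent directions are the supported directions along which the linearized `L₁` norm is
constant. -/
lemma Tangent.sum_beta_eq_zero {ℓ : Fin F.N → ℝ} {h : Fin F.p → ℝ} (hh : F.Tangent ℓ h) :
    ∑ j, ℓ j * F.β h j = 0 := by
  have h1 : ∑ j, ℓ j * F.β h j = ∑ r, h r * F.a1 ℓ r := by
    simp only [β, Finset.mul_sum]
    rw [Finset.sum_comm]
    refine Finset.sum_congr rfl fun r _ => ?_
    by_cases hr : r ∈ F.active
    · simp only [a1, hr, if_true, Finset.mul_sum]
      exact Finset.sum_congr rfl fun j _ => by ring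
    · simp [hh.1 r hr]
  rw [h1]
  by_cases h0 : F.norm2 (F.a1 ℓ) = 0
  · simp [norm2_eq_zero h0]
  · have h2 : ∑ r, h r * F.fa ℓ r = (∑ r, h r * F.a1 ℓ r) / F.norm2 (F.a1 ℓ) := by
      rw [Finset.sum_div]; exact Finset.sum_congr rfl fun r _ => by rw [fa]; ring
    have h3 := hh.2
    rw [h2, div_eq_zero_iff] at h3
    exact h3.resolve_right h0

variable {𝒪 : Type*} {n : ℕ} {L : (Cube d → ℝ) → 𝒪 → ℝ}

theorem IsPCHAGL.exists_subgradient_solvesTangentScores {o : Fin n → 𝒪} (hF : F.IsPCHAGL L o)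
    (hL : PathwiseDifferentiable L k) :
    ∃ ℓ : Fin F.N → ℝ, F.IsSubgradient ℓ ∧ F.SolvesTangentScores L o ℓ := by
  rcases ((F.svn_nonneg _).trans hF.2.1).eq_or_lt with hC | hC
  · -- with `C = 0` the fit vanishes, and so does every supported direction
    have hβ : F.β F.α = 0 := by
      have h0 : F.svn F.α = 0 := le_antisymm (hF.2.1.trans hC.symm.le) (F.svn_nonneg _)
      funext j
      simpa using (Finset.sum_eq_zero_iff_of_nonneg fun j _ => abs_nonneg (F.β F.α j)).1 h0 j
        (Finset.mem_univ j)
    have hα : F.α = 0 := hF.1.betaLin_injective (by rw [betaLin_apply, hβ, map_zero])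
    refine ⟨0, fun b => ?_, fun h hh => ?_⟩
    · simpa [hβ] using Finset.sum_nonneg fun j (_ : j ∈ Finset.univ) => abs_nonneg (b j)
    · have : h = 0 := funext fun r => hh.1 r (by simp [active, hα])
      rw [← empScore_apply hL, this, map_zero]
  · obtain ⟨ℓ, lam, h1, h2⟩ := exists_subgradient_of_isMax F.betaLin hF.1.betaLin_injective
      (-F.empScore hL o) hC F.α hF.2.1
      (fun v hv => by simpa using hF.empScore_sub_nonneg hL hv)
    refine ⟨ℓ, h1, fun h hh => ?_⟩
    have h3 := h2 h
    simp only [betaLin_apply, hh.sum_beta_eq_zero, mul_zero, LinearMap.neg_apply] at h3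
    rw [← empScore_apply hL]
    linarith

theorem IsPCHAGL.solvesTangentScores_sign {o : Fin n → 𝒪} (hF : F.IsPCHAGL L o)
    (hL : PathwiseDifferentiable L k) (hβ : ∀ j, F.β F.α j ≠ 0) :
    F.SolvesTangentScores L o (fun j => Real.sign (F.β F.α j)) := by
  obtain ⟨ℓ, h1, h2⟩ := hF.exists_subgradient_solvesTangentScores hL
  rwa [eq_sign_of_subgradient hβ h1] at h2

end PCFit

/-! ### Splines are càdlàg with finite sectional variation norm -/

section Spline

variable {d k : ℕ}

lemma splineFactor_monotone (c : Fin (k + 2)) (v : unitInterval) :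
    Monotone fun x : unitInterval => splineFactor k c v x := by
  intro x y hxy
  have hxy' : (x : ℝ) ≤ y := hxy
  simp only [splineFactor]
  split_ifs with h1 h2 h3 h3
  · have := x.2.1
    gcongr
  · have : (0 : ℝ) ≤ (x : ℝ) - v := sub_nonneg.2 h2
    gcongr
  · exact absurd (h2.trans hxy') h3
  · have : (0 : ℝ) ≤ (y : ℝ) - v := sub_nonneg.2 h3
    positivity
  · exact le_rfl

lemma splineFactor_nonneg (c : Fin (k + 2)) (v x : unitInterval) : 0 ≤ splineFactor k c v x := by
  have := x.2.1
  simp only [splineFactor]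
  split_ifs with h1 h2
  · positivity
  · have : (0 : ℝ) ≤ (x : ℝ) - v := sub_nonneg.2 h2
    positivity
  · exact le_rfl

lemma splineFactor_rightContinuous (c : Fin (k + 2)) (v x : unitInterval) :
    ContinuousWithinAt (fun y : unitInterval => splineFactor k c v y) (Set.Ici x) x := by
  by_cases h1 : (c : ℕ) ≤ k
  · simp only [splineFactor, h1, if_true]
    exact Continuous.continuousWithinAt (by fun_prop)
  · simp only [splineFactor, h1, if_false]
    by_cases h2 : (v : ℝ) ≤ x
    · have hc : ContinuousWithinAt (fun y : unitInterval => ((y : ℝ) - v) ^ k / (k ! : ℝ))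
          (Set.Ici x) x := Continuous.continuousWithinAt (by fun_prop)
      refine hc.congr (fun y hy => ?_) (if_pos h2)
      exact if_pos (h2.trans (show (x : ℝ) ≤ y from hy))
    · refine ContinuousAt.continuousWithinAt ?_
      have hev : ∀ᶠ y : unitInterval in 𝓝 x, (y : ℝ) < v :=
        continuous_subtype_val.continuousAt.eventually_lt continuousAt_const (not_le.1 h2)
      refine (continuousAt_const (y := (0 : ℝ))).congr ?_
      filter_upwards [hev] with y hy
      exact (if_neg (not_le.2 hy)).symm

/-- A product of right-continuous monotone functions of the coordinates is càdlàg. -/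
lemma isCadlag_prod {g : Fin d → unitInterval → ℝ} (hm : ∀ i, Monotone (g i))
    (hc : ∀ i x, ContinuousWithinAt (g i) (Set.Ici x) x) :
    IsCadlag fun x : Cube d => ∏ i, g i (x i) := by
  refine ⟨fun x => ?_, fun x s => ?_⟩
  · refine tendsto_finsetProd _ fun i _ => ?_
    refine (hc i (x i)).tendsto.comp (tendsto_nhdsWithin_iff.2 ⟨?_, ?_⟩)
    · exact ((continuous_apply i).tendsto x).mono_left nhdsWithin_le_nhds
    · filter_upwards [self_mem_nhdsWithin] with y hy using hy i
  · have hlim : ∀ i, ∃ l, Tendsto (fun y : Cube d => g i (y i))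
        (𝓝[{y | ∀ i, (i ∈ s → y i < x i) ∧ (i ∉ s → x i ≤ y i)}] x) (𝓝 l) := by
      intro i
      have hcoord : Tendsto (fun y : Cube d => y i)
          (𝓝[{y | ∀ i, (i ∈ s → y i < x i) ∧ (i ∉ s → x i ≤ y i)}] x) (𝓝 (x i)) :=
        ((continuous_apply i).tendsto x).mono_left nhdsWithin_le_nhds
      by_cases hi : i ∈ s
      · refine ⟨_, ((hm i).tendsto_nhdsLT (x i)).comp (tendsto_nhdsWithin_iff.2 ⟨hcoord, ?_⟩)⟩
        filter_upwards [self_mem_nhdsWithin] with y hy using (hy i).1 hi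
      · refine ⟨_, (hc i (x i)).tendsto.comp (tendsto_nhdsWithin_iff.2 ⟨hcoord, ?_⟩)⟩
        filter_upwards [self_mem_nhdsWithin] with y hy using (hy i).2 hi
    choose l hl using hlim
    exact ⟨∏ i, l i, tendsto_finsetProd _ fun i _ => hl i⟩

lemma sectionIncrement_prod (g : Fin d → unitInterval → ℝ) (s : Finset (Fin d)) (a b : Cube d) :
    sectionIncrement (fun x : Cube d => ∏ i, g i (x i)) s a b =
      ∏ i, if i ∈ s then g i (b i) - g i (a i) else g i 0 := by
  have hs : ∏ i, (if i ∈ s then g i (b i) - g i (a i) else g i 0) =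
      (∏ i ∈ s, (g i (b i) + -g i (a i))) * ∏ i ∈ sᶜ, g i 0 := by
    rw [← Finset.prod_mul_prod_compl s]
    congr 1
    · exact Finset.prod_congr rfl fun i hi => by simp [hi, sub_eq_add_neg]
    · exact Finset.prod_congr rfl fun i hi => by simp [Finset.mem_compl.1 hi]
  rw [hs, Finset.prod_add, Finset.sum_mul, sectionIncrement]
  refine Finset.sum_congr rfl fun t ht => ?_
  have hts : t ⊆ s := Finset.mem_powerset.1 ht
  rw [← Finset.prod_mul_prod_compl s, ← Finset.prod_sdiff hts, Finset.prod_neg]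
  have h1 : ∏ i ∈ s \ t, g i (if i ∈ t then b i else if i ∈ s then a i else 0) =
      ∏ i ∈ s \ t, g i (a i) :=
    Finset.prod_congr rfl fun i hi => by
      rw [if_neg (Finset.mem_sdiff.1 hi).2, if_pos (Finset.mem_sdiff.1 hi).1]
  have h2 : ∏ i ∈ t, g i (if i ∈ t then b i else if i ∈ s then a i else 0) =
      ∏ i ∈ t, g i (b i) := Finset.prod_congr rfl fun i hi => by rw [if_pos hi]
  have h3 : ∏ i ∈ sᶜ, g i (if i ∈ t then b i else if i ∈ s then a i else 0) =
      ∏ i ∈ sᶜ, g i 0 :=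
    Finset.prod_congr rfl fun i hi => by
      have := Finset.mem_compl.1 hi
      rw [if_neg fun h => this (hts h), if_neg this]
  rw [h1, h2, h3]
  ring

/-- The increments of a product factorize over the coordinates, so that their absolute values sum to
a product of telescoping sums. -/
lemma sectionVariation_prod_le {g : Fin d → unitInterval → ℝ} (hm : ∀ i, Monotone (g i))
    (h0 : ∀ i x, 0 ≤ g i x) (s : Finset (Fin d)) :
    sectionVariation (fun x : Cube d => ∏ i, g i (x i)) s ≤ ENNReal.ofReal (∏ i, g i 1) := by
  refine iSup_le fun n => iSup_le fun u => iSup_le fun hu => ?_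
  rw [← ENNReal.ofReal_sum_of_nonneg fun _ _ => abs_nonneg _]
  refine ENNReal.ofReal_le_ofReal ?_
  have hfac : ∀ j : Fin d → ℕ,
      |sectionIncrement (fun x : Cube d => ∏ i, g i (x i)) s (fun i => u i (j i))
        (fun i => u i (j i + 1))| =
      ∏ i, if i ∈ s then g i (u i (j i + 1)) - g i (u i (j i)) else g i 0 := fun j => by
    rw [sectionIncrement_prod, abs_of_nonneg]
    refine Finset.prod_nonneg fun i _ => ?_
    split_ifs
    · exact sub_nonneg.2 (hm i (hu i (Nat.le_succ _)))
    · exact h0 i 0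
  simp only [hfac]
  rw [← Finset.prod_univ_sum (fun i => if i ∈ s then Finset.range n else {0})
    (fun i m => if i ∈ s then g i (u i (m + 1)) - g i (u i m) else g i 0)]
  refine Finset.prod_le_prod (fun i _ => Finset.sum_nonneg fun m _ => ?_) fun i _ => ?_
  · split_ifs
    · exact sub_nonneg.2 (hm i (hu i (Nat.le_succ _)))
    · exact h0 i 0
  · by_cases hi : i ∈ s
    · simp only [hi, if_true]
      rw [Finset.sum_range_sub (fun m => g i (u i m))]
      linarith [h0 i (u i 0), hm i (unitInterval.le_one' (t := u i n))]
    · simp only [hi, if_false, Finset.sum_singleton]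
      exact hm i (unitInterval.le_one' (t := 0))

lemma spline_mem_D0 (c : Fin d → Fin (k + 2)) (v : Cube d) : spline k c v ∈ D0 d := by
  refine ⟨isCadlag_prod (fun i => splineFactor_monotone (c i) (v i))
    (fun i x => splineFactor_rightContinuous (c i) (v i) x), ?_⟩
  refine ENNReal.sum_lt_top.2 fun s _ => ?_
  exact (sectionVariation_prod_le (fun i => splineFactor_monotone (c i) (v i))
    (fun i x => splineFactor_nonneg (c i) (v i) x) s).trans_lt ENNReal.ofReal_lt_top

lemma IsCadlag.add {f g : Cube d → ℝ} (hf : IsCadlag f) (hg : IsCadlag g) : IsCadlag (f + g) :=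
  ⟨fun x => (hf.1 x).add (hg.1 x), fun x s =>
    let ⟨l, hl⟩ := hf.2 x s
    let ⟨m, hm⟩ := hg.2 x s
    ⟨l + m, hl.add hm⟩⟩

lemma IsCadlag.smul {f : Cube d → ℝ} (hf : IsCadlag f) (c : ℝ) : IsCadlag (c • f) :=
  ⟨fun x => (hf.1 x).const_smul c, fun x s =>
    let ⟨l, hl⟩ := hf.2 x s
    ⟨c • l, hl.const_smul c⟩⟩

lemma sum_le_sectionVariation (f : Cube d → ℝ) (s : Finset (Fin d)) (n : ℕ)
    (u : Fin d → ℕ → unitInterval) (hu : ∀ i, Monotone (u i)) :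
    ∑ j ∈ Fintype.piFinset (fun i => if i ∈ s then Finset.range n else {0}),
      ENNReal.ofReal |sectionIncrement f s (fun i => u i (j i)) (fun i => u i (j i + 1))| ≤
      sectionVariation f s :=
  le_trans (le_iSup (fun _ : ∀ i, Monotone (u i) => _) hu) (le_iSup₂_of_le n u le_rfl)

lemma sectionVariation_add_le (f g : Cube d → ℝ) (s : Finset (Fin d)) :
    sectionVariation (f + g) s ≤ sectionVariation f s + sectionVariation g s := by
  refine iSup_le fun n => iSup_le fun u => iSup_le fun hu => ?_
  refine le_trans ?_ (add_le_add
    (sum_le_sectionVariation f s n u hu) (sum_le_sectionVariation g s n u hu))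
  rw [← Finset.sum_add_distrib]
  refine Finset.sum_le_sum fun j _ => ?_
  rw [← ENNReal.ofReal_add (abs_nonneg _) (abs_nonneg _)]
  refine ENNReal.ofReal_le_ofReal ?_
  have : ∀ a b : Cube d, sectionIncrement (f + g) s a b =
      sectionIncrement f s a b + sectionIncrement g s a b := fun a b => by
    simp [sectionIncrement, mul_add, Finset.sum_add_distrib]
  rw [this]
  exact abs_add_le _ _

lemma sectionVariation_smul_le (c : ℝ) (f : Cube d → ℝ) (s : Finset (Fin d)) :
    sectionVariation (c • f) s ≤ ENNReal.ofReal |c| * sectionVariation f s := by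
  refine iSup_le fun n => iSup_le fun u => iSup_le fun hu => ?_
  refine le_trans ?_ (mul_le_mul_right
    (sum_le_sectionVariation f s n u hu) _)
  rw [Finset.mul_sum]
  refine Finset.sum_le_sum fun j _ => ?_
  rw [← ENNReal.ofReal_mul (abs_nonneg _), ← abs_mul]
  refine ENNReal.ofReal_le_ofReal (le_of_eq ?_)
  congr 1
  simp only [sectionIncrement, Finset.mul_sum, Pi.smul_apply, smul_eq_mul]
  exact Finset.sum_congr rfl fun t _ => by ring

lemma add_mem_D0 {f g : Cube d → ℝ} (hf : f ∈ D0 d) (hg : g ∈ D0 d) : f + g ∈ D0 d := by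
  refine ⟨hf.1.add hg.1, ENNReal.sum_lt_top.2 fun s _ => ?_⟩
  exact (sectionVariation_add_le f g s).trans_lt (ENNReal.add_lt_top.2
    ⟨ENNReal.sum_lt_top.1 hf.2 s (Finset.mem_univ s),
      ENNReal.sum_lt_top.1 hg.2 s (Finset.mem_univ s)⟩)

lemma smul_mem_D0 {f : Cube d → ℝ} (c : ℝ) (hf : f ∈ D0 d) : c • f ∈ D0 d := by
  refine ⟨hf.1.smul c, ENNReal.sum_lt_top.2 fun s _ => ?_⟩
  exact (sectionVariation_smul_le c f s).trans_lt (ENNReal.mul_lt_top ENNReal.ofReal_lt_top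
    (ENNReal.sum_lt_top.1 hf.2 s (Finset.mem_univ s)))

lemma splineSpan_subset_D0 {f : Cube d → ℝ} (hf : f ∈ splineSpan d k) : f ∈ D0 d := by
  induction hf using Submodule.span_induction with
  | mem f hf => obtain ⟨q, rfl⟩ := hf; exact spline_mem_D0 q.1 q.2
  | zero => simpa using smul_mem_D0 0 (spline_mem_D0 (k := k) (d := d) (fun _ => 0) (fun _ => 0))
  | add f g _ _ hf hg => exact add_mem_D0 hf hg
  | smul c f _ hf => exact smul_mem_D0 c hf

end Spline

/-! ### Population scores -/

section Population

variable {𝒪 : Type*} [MeasurableSpace 𝒪] {d k : ℕ} {L : (Cube d → ℝ) → 𝒪 → ℝ} {P0 : Measure 𝒪}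
  {ψ₀ : Cube d → ℝ}

/-- The population score vanishes at the risk minimizer: the whole line `ψ₀ + δ f` lies in the
parameter space, since splines belong to it. -/
lemma integral_score_eq_zero (hψ₀ : IsRiskMinimizer L P0 ψ₀)
    (hrisk : RiskDifferentiableAt L P0 k ψ₀) {f : Cube d → ℝ} (hf : f ∈ splineSpan d k) :
    ∫ o, score L ψ₀ f o ∂P0 = 0 := by
  refine IsLocalMin.hasDerivAt_eq_zero (Eventually.of_forall fun δ => ?_) (hrisk f hf).2
  simp only [zero_smul, add_zero]
  exact hψ₀.2 _ (add_mem_D0 hψ₀.1 (smul_mem_D0 δ (splineSpan_subset_D0 hf)))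

lemma aestronglyMeasurable_score (hLint : ∀ ψ ∈ D0 d, Integrable (L ψ) P0)
    (hL : PathwiseDifferentiable L k) {θ f : Cube d → ℝ} (hθ : θ ∈ splineSpan d k)
    (hf : f ∈ splineSpan d k) : AEStronglyMeasurable (score L θ f) P0 := by
  have hint : ∀ δ : ℝ, Integrable (L (θ + δ • f)) P0 := fun δ =>
    hLint _ (splineSpan_subset_D0 (Submodule.add_mem _ hθ (Submodule.smul_mem _ δ hf)))
  refine aestronglyMeasurable_of_tendsto_ae atTop
    (f := fun (j : ℕ) o => slope (fun δ : ℝ => L (θ + δ • f) o) 0 (1 / ((j : ℝ) + 1)))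
    (fun j => ?_) (ae_of_all _ fun o => ?_)
  · simp only [slope_def_field]
    simp only [div_eq_mul_inv]
    exact (((hint _).sub (hint _)).mul_const _).aestronglyMeasurable
  · have hd := ((hL θ hθ f hf o).1).hasDerivAt
    refine (hasDerivAt_iff_tendsto_slope.1 hd).comp (tendsto_nhdsWithin_iff.2
      ⟨tendsto_one_div_add_atTop_nhds_zero_nat, Eventually.of_forall fun j => ?_⟩)
    have : (0 : ℝ) < 1 / ((j : ℝ) + 1) := by positivity
    exact this.ne'

end Population

/-! ### The empirical process and an exponential inequality -/

section EmpiricalProcess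

variable {Ω 𝒪 : Type*} [MeasurableSpace 𝒪]

/-- `O_1, O_2, …` are independent with law `P_0`. -/
structure IsIIDSample [MeasurableSpace Ω] (P : Measure Ω) (P0 : Measure 𝒪) (O : ℕ → Ω → 𝒪) : Prop where
  measurable : ∀ i, Measurable (O i)
  law : ∀ i, P.map (O i) = P0
  indep : iIndepFun O P

/-- The empirical process `√n (P_n - P_0) ξ`. -/
def centredEmp (P0 : Measure 𝒪) (O : ℕ → Ω → 𝒪) (n : ℕ) (ξ : 𝒪 → ℝ) (ω : Ω) : ℝ :=
  Real.sqrt n * (emp (sample O n ω) ξ - ∫ o, ξ o ∂P0)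

variable {P0 : Measure 𝒪} {O : ℕ → Ω → 𝒪} {n : ℕ}

lemma centredEmp_eq_sum (hn : 1 ≤ n) (ξ : 𝒪 → ℝ) (ω : Ω) :
    Real.sqrt n * centredEmp P0 O n ξ ω =
      ∑ i ∈ Finset.range n, (ξ (O i ω) - ∫ o, ξ o ∂P0) := by
  have hn' : (0 : ℝ) < n := by exact_mod_cast hn
  rw [Finset.sum_sub_distrib, Finset.sum_const, Finset.card_range, nsmul_eq_mul, centredEmp,
    ← mul_assoc, Real.mul_self_sqrt hn'.le, emp, mul_sub, ← mul_assoc, mul_inv_cancel₀ hn'.ne',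
    one_mul, ← Fin.sum_univ_eq_sum_range (fun i => ξ (O i ω))]
  rfl

lemma centredEmp_add {ξ ψ : 𝒪 → ℝ} (hξ : Integrable ξ P0) (hψ : Integrable ψ P0) (ω : Ω) :
    centredEmp P0 O n (fun o => ξ o + ψ o) ω =
      centredEmp P0 O n ξ ω + centredEmp P0 O n ψ ω := by
  rw [centredEmp, emp_add, integral_add hξ hψ, centredEmp, centredEmp]; ring

lemma centredEmp_neg (ξ : 𝒪 → ℝ) (ω : Ω) :
    centredEmp P0 O n (fun o => -ξ o) ω = -centredEmp P0 O n ξ ω := by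
  have := emp_mul (sample O n ω) (-1) ξ
  simp only [neg_one_mul] at this
  rw [centredEmp, this, integral_neg, centredEmp]; ring

lemma abs_centredEmp_le_of_nonneg {ξ ψ : 𝒪 → ℝ} (h0 : ∀ o, 0 ≤ ξ o) (hle : ∀ o, ξ o ≤ ψ o)
    (hξ : Integrable ξ P0) (hψ : Integrable ψ P0) (ω : Ω) :
    |centredEmp P0 O n ξ ω| ≤
      |centredEmp P0 O n ψ ω| + 2 * (Real.sqrt n * ∫ o, ψ o ∂P0) := by
  have hs := Real.sqrt_nonneg (n : ℝ)
  have h1 : 0 ≤ emp (sample O n ω) ξ :=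
    mul_nonneg (by positivity) (Finset.sum_nonneg fun _ _ => h0 _)
  have h2 := mul_le_mul_of_nonneg_left (emp_mono (o := sample O n ω) hle) hs
  have h3 := mul_le_mul_of_nonneg_left (integral_mono hξ hψ hle) hs
  have h4 := mul_nonneg hs (integral_nonneg (μ := P0) h0)
  have h5 := le_abs_self (centredEmp P0 O n ψ ω)
  have h7 := mul_nonneg hs h1
  have h6 : centredEmp P0 O n ψ ω =
    Real.sqrt n * emp (sample O n ω) ψ - Real.sqrt n * ∫ o, ψ o ∂P0 := by rw [centredEmp]; ring
  have h8 : centredEmp P0 O n ξ ω =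
    Real.sqrt n * emp (sample O n ω) ξ - Real.sqrt n * ∫ o, ξ o ∂P0 := by rw [centredEmp]; ring
  have h9 := abs_nonneg (centredEmp P0 O n ψ ω)
  rw [abs_le]
  constructor <;> linarith

lemma abs_centredEmp_le {ξ ψ : 𝒪 → ℝ} (hle : ∀ o, |ξ o| ≤ ψ o) (hψ : Integrable ψ P0) (ω : Ω) :
    |centredEmp P0 O n ξ ω| ≤ Real.sqrt n * (emp (sample O n ω) ψ + ∫ o, ψ o ∂P0) := by
  rw [centredEmp, abs_mul, abs_of_nonneg (Real.sqrt_nonneg _)]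
  refine mul_le_mul_of_nonneg_left ((abs_sub _ _).trans (add_le_add ?_ ?_)) (Real.sqrt_nonneg _)
  · rw [emp, abs_mul, abs_of_nonneg (by positivity), emp]
    exact mul_le_mul_of_nonneg_left ((Finset.abs_sum_le_sum_abs _ _).trans
      (Finset.sum_le_sum fun _ _ => hle _)) (by positivity)
  · simpa using norm_integral_le_of_norm_le (f := ξ) hψ (ae_of_all _ fun o => by simpa using hle o)

/-- Bernstein's bound for the moment generating function of a centred bounded variable. -/
lemma mgf_centred_le [IsProbabilityMeasure P0] {ξ : 𝒪 → ℝ} (hξ : AEStronglyMeasurable ξ P0)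
    {b v t : ℝ} (hb : ∀ o, |ξ o| ≤ b) (hv : ∫ o, ξ o ^ 2 ∂P0 ≤ v) (ht : 2 * b * |t| ≤ 1) :
    mgf (fun o => ξ o - ∫ z, ξ z ∂P0) P0 t ≤ Real.exp (t ^ 2 * v) := by
  have hint : Integrable ξ P0 := Integrable.of_bound hξ b (ae_of_all _ fun o => by simpa using hb o)
  have hint2 : Integrable (fun o => ξ o ^ 2) P0 :=
    Integrable.of_bound (hξ.pow 2) (b ^ 2) (ae_of_all _ fun o => by
      rw [Real.norm_eq_abs, abs_pow]; exact pow_le_pow_left₀ (abs_nonneg _) (hb o) 2)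
  set m := ∫ z, ξ z ∂P0 with hm
  have hmb : |m| ≤ b := by
    simpa using norm_integral_le_of_norm_le_const (μ := P0) (f := ξ)
        (ae_of_all _ fun o => by simpa using hb o)
  have hY : ∀ o, |ξ o - m| ≤ 2 * b := fun o => (abs_sub _ _).trans (by linarith [hb o])
  have hYt : ∀ o, |t * (ξ o - m)| ≤ 1 := fun o => by
    rw [abs_mul]
    nlinarith [hY o, abs_nonneg t]
  have hYint : Integrable (fun o => ξ o - m) P0 := hint.sub (integrable_const _)
  have hY2eq : (fun o => (ξ o - m) ^ 2) = fun o => (ξ o ^ 2 - 2 * m * ξ o) + m ^ 2 := by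
    funext o; ring
  have hI2 : Integrable (fun o => ξ o ^ 2 - 2 * m * ξ o) P0 := hint2.sub (hint.const_mul _)
  have hY2 : Integrable (fun o => (ξ o - m) ^ 2) P0 := by
    rw [hY2eq]; exact hI2.add (integrable_const _)
  have hvar : ∫ o, (ξ o - m) ^ 2 ∂P0 ≤ v := by
    rw [hY2eq, integral_add hI2 (integrable_const _),
      integral_sub hint2 (hint.const_mul _), integral_const_mul, ← hm]
    simp
    nlinarith [sq_nonneg m]
  have hmean : ∫ o, (ξ o - m) ∂P0 = 0 := by
    rw [integral_sub hint (integrable_const _)]; simp [hm]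
  have hexp : ∀ o, Real.exp (t * (ξ o - m)) ≤ 1 + (t * (ξ o - m) + t ^ 2 * (ξ o - m) ^ 2) :=
    fun o => by
      have := (abs_le.1 (Real.abs_exp_sub_one_sub_id_le (hYt o))).2
      nlinarith
  have hI1 : Integrable (fun o => t * (ξ o - m) + t ^ 2 * (ξ o - m) ^ 2) P0 :=
    (hYint.const_mul _).add (hY2.const_mul _)
  have hI : Integrable (fun o => 1 + (t * (ξ o - m) + t ^ 2 * (ξ o - m) ^ 2)) P0 :=
    (integrable_const _).add hI1
  calc mgf (fun o => ξ o - m) P0 t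
      ≤ ∫ o, (1 + (t * (ξ o - m) + t ^ 2 * (ξ o - m) ^ 2)) ∂P0 :=
        integral_mono_of_nonneg (ae_of_all _ fun o => (Real.exp_pos _).le) hI (ae_of_all _ hexp)
    _ = 1 + t ^ 2 * ∫ o, (ξ o - m) ^ 2 ∂P0 := by
        rw [integral_add (integrable_const _) hI1,
          integral_add (hYint.const_mul _) (hY2.const_mul _), integral_const_mul,
          integral_const_mul, hmean]
        simp
    _ ≤ t ^ 2 * v + 1 := by nlinarith [sq_nonneg t]
    _ ≤ _ := Real.add_one_le_exp _

variable [MeasurableSpace Ω] {P : Measure Ω}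

lemma IsIIDSample.aestronglyMeasurable_comp (h : IsIIDSample P P0 O) {ξ : 𝒪 → ℝ}
    (hξ : AEStronglyMeasurable ξ P0) (i : ℕ) : AEStronglyMeasurable (fun ω => ξ (O i ω)) P :=
  AEStronglyMeasurable.comp_measurable (by rwa [h.law i]) (h.measurable i)

variable [IsProbabilityMeasure P] [IsProbabilityMeasure P0]

lemma IsIIDSample.measure_le_centredEmp (h : IsIIDSample P P0 O) (hn : 1 ≤ n) {ξ : 𝒪 → ℝ}
    (hξ : AEStronglyMeasurable ξ P0) {b v s : ℝ} (hb : ∀ o, |ξ o| ≤ b)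
    (hv : ∫ o, ξ o ^ 2 ∂P0 ≤ v) (hs : 0 ≤ s) (hbs : 2 * b * s ≤ Real.sqrt n) (x : ℝ) :
    P {ω | x ≤ centredEmp P0 O n ξ ω} ≤ ENNReal.ofReal (Real.exp (s ^ 2 * v - s * x)) := by
  have hn' : (0 : ℝ) < n := by exact_mod_cast hn
  have hsn : 0 < Real.sqrt n := Real.sqrt_pos.2 hn'
  set m := ∫ z, ξ z ∂P0 with hm
  set t := s / Real.sqrt n with ht
  have ht0 : 0 ≤ t := by positivity
  let Y : ℕ → Ω → ℝ := fun i ω => ξ (O i ω) - m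
  have hξm : AEMeasurable (fun z => ξ z - m) P0 := (hξ.sub aestronglyMeasurable_const).aemeasurable
  have hYm : ∀ i, AEMeasurable (Y i) P := fun i =>
    ((h.aestronglyMeasurable_comp hξ i).sub aestronglyMeasurable_const).aemeasurable
  have hYind : iIndepFun Y P := h.indep.comp₀ (fun _ z => ξ z - m)
    (fun i => (h.measurable i).aemeasurable) (fun i => by rw [h.law i]; exact hξm)
  have hmgf : ∀ i, mgf (Y i) P t ≤ Real.exp (t ^ 2 * v) := fun i => by
    have h1 : mgf (Y i) P t = mgf (fun z => ξ z - m) P0 t := by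
      rw [← h.law i, mgf_map (h.measurable i).aemeasurable]
      · rfl
      · rw [h.law i]
        exact (Real.continuous_exp.measurable.comp_aemeasurable
          (hξm.const_mul t)).aestronglyMeasurable
    rw [h1]
    refine mgf_centred_le hξ hb hv ?_
    rw [abs_of_nonneg ht0, ht, mul_div_assoc', div_le_one hsn]
    exact hbs
  have hmgfS : mgf (∑ i ∈ Finset.range n, Y i) P t ≤ Real.exp (s ^ 2 * v) := by
    rw [hYind.mgf_sum₀ hYm]
    refine (Finset.prod_le_prod (fun i _ => mgf_nonneg) fun i _ => hmgf i).trans (le_of_eq ?_)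
    rw [Finset.prod_const, Finset.card_range, ← Real.exp_nat_mul]
    congr 1
    rw [ht, div_pow, Real.sq_sqrt hn'.le]
    field_simp
  have hb' : ∀ i ω, |Y i ω| ≤ 2 * b := fun i ω => by
    have hmb : |m| ≤ b := by
      simpa using norm_integral_le_of_norm_le_const (μ := P0) (f := ξ)
        (ae_of_all _ fun o => by simpa using hb o)
    exact (abs_sub _ _).trans (by linarith [hb (O i ω)])
  have hint : Integrable (fun ω => Real.exp (t * (∑ i ∈ Finset.range n, Y i) ω)) P := by
    refine Integrable.of_bound (C := Real.exp (t * (n * (2 * b)))) ?_ (ae_of_all _ fun ω => ?_)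
    · exact (Real.continuous_exp.measurable.comp_aemeasurable
        ((Finset.aemeasurable_sum _ fun i _ => hYm i).const_mul t)).aestronglyMeasurable
    · rw [Real.norm_eq_abs, abs_of_pos (Real.exp_pos _), Real.exp_le_exp, Finset.sum_apply]
      refine mul_le_mul_of_nonneg_left ?_ ht0
      refine (Finset.sum_le_sum fun i _ => (le_abs_self _).trans (hb' i ω)).trans ?_
      simp
  have hset : {ω | x ≤ centredEmp P0 O n ξ ω} =
      {ω | Real.sqrt n * x ≤ (∑ i ∈ Finset.range n, Y i) ω} := by
    ext ω
    simp only [Set.mem_ofPred_eq, Finset.sum_apply, Y, hm, ← centredEmp_eq_sum hn]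
    exact (mul_le_mul_iff_right₀ hsn).symm
  have hmain := measure_ge_le_exp_mul_mgf (Real.sqrt n * x) ht0 hint
  rw [hset, ← ENNReal.ofReal_toReal (measure_ne_top P _)]
  refine ENNReal.ofReal_le_ofReal (hmain.trans ?_)
  rw [show s ^ 2 * v - s * x = -t * (Real.sqrt n * x) + s ^ 2 * v by
    rw [ht]; field_simp; ring, Real.exp_add]
  exact mul_le_mul_of_nonneg_left hmgfS (Real.exp_pos _).le

/-- Exponential inequality in the sub-Gaussian range: for `|ξ| ≤ √n σ / (2 s)` and `‖ξ‖_{P_0} ≤ σ`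
the empirical process exceeds `3 σ s` with probability at most `2 exp(-2 s²)`. -/
lemma IsIIDSample.measure_lt_abs_centredEmp (h : IsIIDSample P P0 O) (hn : 1 ≤ n) {ξ : 𝒪 → ℝ}
    (hξ : AEStronglyMeasurable ξ P0) {σ s : ℝ} (hσ : 0 < σ) (hs : 0 < s)
    (hb : ∀ o, |ξ o| ≤ Real.sqrt n * σ / (2 * s)) (hv : ∫ o, ξ o ^ 2 ∂P0 ≤ σ ^ 2) :
    P {ω | 3 * σ * s < |centredEmp P0 O n ξ ω|} ≤ 2 * ENNReal.ofReal (Real.exp (-2 * s ^ 2)) := by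
  have h1 := h.measure_le_centredEmp hn hξ hb hv (s := s / σ) (by positivity)
    (by field_simp; exact le_rfl) (3 * σ * s)
  have h2 := h.measure_le_centredEmp hn hξ.neg (b := Real.sqrt n * σ / (2 * s)) (v := σ ^ 2)
    (by simpa using hb) (by simpa using hv) (s := s / σ) (by positivity)
    (by field_simp; exact le_rfl) (3 * σ * s)
  have he : (s / σ) ^ 2 * σ ^ 2 - s / σ * (3 * σ * s) = -2 * s ^ 2 := by field_simp; ring
  rw [he] at h1 h2
  rw [two_mul]
  refine (measure_mono ?_).trans ((measure_union_le _ _).trans (add_le_add h1 h2))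
  intro ω hω
  rcases le_abs.1 (le_of_lt (Set.mem_ofPred_eq ▸ hω)) with h | h
  · exact Or.inl h
  · right
    have := centredEmp_neg (P0 := P0) (O := O) (n := n) ξ ω
    change _ ≤ centredEmp P0 O n (fun o => -ξ o) ω
    rwa [this]

lemma IsIIDSample.measure_exists_lt_abs_centredEmp (h : IsIIDSample P P0 O) (hn : 1 ≤ n)
    {ι : Type*} (T : Finset ι) {ξ : ι → 𝒪 → ℝ} {σ s : ℝ} (hσ : 0 < σ) (hs : 0 < s)
    (hcard : (T.card : ℝ) ≤ Real.exp (s ^ 2))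
    (hξ : ∀ t ∈ T, AEStronglyMeasurable (ξ t) P0)
    (hb : ∀ t ∈ T, ∀ o, |ξ t o| ≤ Real.sqrt n * σ / (2 * s))
    (hv : ∀ t ∈ T, ∫ o, ξ t o ^ 2 ∂P0 ≤ σ ^ 2) :
    P {ω | ∃ t ∈ T, 3 * σ * s < |centredEmp P0 O n (ξ t) ω|} ≤
      2 * ENNReal.ofReal (Real.exp (-s ^ 2)) := by
  have hset : {ω | ∃ t ∈ T, 3 * σ * s < |centredEmp P0 O n (ξ t) ω|} =
      ⋃ t ∈ T, {ω | 3 * σ * s < |centredEmp P0 O n (ξ t) ω|} := by ext ω; simp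
  rw [hset]
  calc P (⋃ t ∈ T, {ω | 3 * σ * s < |centredEmp P0 O n (ξ t) ω|})
      ≤ ∑ t ∈ T, P {ω | 3 * σ * s < |centredEmp P0 O n (ξ t) ω|} := measure_biUnion_finset_le _ _
    _ ≤ ∑ t ∈ T, 2 * ENNReal.ofReal (Real.exp (-2 * s ^ 2)) :=
        Finset.sum_le_sum fun t ht =>
          h.measure_lt_abs_centredEmp hn (hξ t ht) hσ hs (hb t ht) (hv t ht)
    _ = 2 * ENNReal.ofReal (T.card * Real.exp (-2 * s ^ 2)) := by
        rw [Finset.sum_const, nsmul_eq_mul, ENNReal.ofReal_mul (by positivity),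
          ENNReal.ofReal_natCast]
        ring
    _ ≤ _ := by
        gcongr
        calc (T.card : ℝ) * Real.exp (-2 * s ^ 2)
            ≤ Real.exp (s ^ 2) * Real.exp (-2 * s ^ 2) := by gcongr
          _ = Real.exp (-s ^ 2) := by rw [← Real.exp_add]; congr 1; ring

/-- Square-integrable functions truncated from below at height `√n a` are asymptotically negligible
for the empirical process. -/
lemma IsIIDSample.tendsto_measure_tail (h : IsIIDSample P P0 O) {ψ : 𝒪 → ℝ} (hψ : MemLp ψ 2 P0)
    {a y : ℝ} (ha : 0 < a) (hy : 0 < y) :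
    Tendsto (fun n : ℕ => P {ω | y < Real.sqrt n *
      (emp (sample O n ω) ({o | Real.sqrt n * a < |ψ o|}.indicator fun o => |ψ o|) +
        ∫ o, {o | Real.sqrt n * a < |ψ o|}.indicator (fun o => |ψ o|) o ∂P0)}) atTop (𝓝 0) := by
  set ξ : ℕ → 𝒪 → ℝ := fun n => {o | Real.sqrt n * a < |ψ o|}.indicator fun o => |ψ o| with hξ
  have hξ0 : ∀ n o, 0 ≤ ξ n o := fun n o => Set.indicator_nonneg (fun _ _ => abs_nonneg _) _
  have hψabs : AEStronglyMeasurable (fun o => |ψ o|) P0 := by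
    simpa using hψ.aestronglyMeasurable.norm
  have hset : ∀ n : ℕ, NullMeasurableSet {o | Real.sqrt n * a < |ψ o|} P0 := fun n =>
    nullMeasurableSet_lt aemeasurable_const hψabs.aemeasurable
  have hξm : ∀ n, AEStronglyMeasurable (ξ n) P0 := fun n => hψabs.indicator₀ (hset n)
  have hψint : Integrable (fun o => |ψ o|) P0 := by
    simpa using (hψ.integrable (by norm_num)).norm
  have hξint : ∀ n, Integrable (ξ n) P0 := fun n => hψint.mono (hξm n) (ae_of_all _ fun o => by
    rw [Real.norm_eq_abs, abs_of_nonneg (hξ0 n o), Real.norm_eq_abs, abs_abs]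
    exact Set.indicator_le_self' (fun _ _ => abs_nonneg _) _)
  have hsq : Integrable (fun o => ψ o ^ 2) P0 := hψ.integrable_sq
  set χ : ℕ → 𝒪 → ℝ := fun n => {o | Real.sqrt n * a < |ψ o|}.indicator fun o => ψ o ^ 2 with hχ
  have hlim : Tendsto (fun n => ∫ o, χ n o ∂P0) atTop (𝓝 0) := by
    have : Tendsto (fun n => ∫ o, χ n o ∂P0) atTop (𝓝 (∫ o, (0 : ℝ) ∂P0)) := by
      refine tendsto_integral_of_dominated_convergence (fun o => ψ o ^ 2)
        (fun n => hsq.aestronglyMeasurable.indicator₀ (hset n)) hsq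
        (fun n => ae_of_all _ fun o => ?_) (ae_of_all _ fun o => ?_)
      · rw [Real.norm_eq_abs, abs_of_nonneg (Set.indicator_nonneg (fun _ _ => sq_nonneg _) _)]
        exact Set.indicator_le_self' (fun _ _ => sq_nonneg _) _
      · refine tendsto_const_nhds.congr' ?_
        have hsqrt : Tendsto (fun n : ℕ => Real.sqrt n * a) atTop atTop :=
          (Real.tendsto_sqrt_atTop.comp tendsto_natCast_atTop_atTop).atTop_mul_const ha
        filter_upwards [hsqrt.eventually_ge_atTop (|ψ o|)] with n hn
        exact (Set.indicator_of_notMem (by simpa using hn) _).symm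
    simpa using this
  have hle : ∀ n : ℕ, Real.sqrt n * ∫ o, ξ n o ∂P0 ≤ (∫ o, χ n o ∂P0) / a := fun n => by
    rw [le_div_iff₀ ha, mul_right_comm, ← integral_const_mul]
    refine integral_mono ((hξint n).const_mul _) (hsq.indicator₀ (hset n)) fun o => ?_
    simp only [hξ, hχ, Set.indicator_apply, Set.mem_ofPred_eq]
    split_ifs with ho
    · rw [← sq_abs (ψ o), sq]
      exact mul_le_mul_of_nonneg_right ho.le (abs_nonneg _)
    · simp
  have hcomp : ∀ n i, Integrable (fun ω => ξ n (O i ω)) P := fun n i =>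
    Integrable.comp_measurable (g := ξ n) (by rw [h.law]; exact hξint n) (h.measurable i)
  have hmean : ∀ n : ℕ, 1 ≤ n → ∫ ω, emp (sample O n ω) (ξ n) ∂P = ∫ o, ξ n o ∂P0 := by
    intro n hn
    have hn' : (n : ℝ) ≠ 0 := by positivity
    have hi : ∀ i, ∫ ω, ξ n (O i ω) ∂P = ∫ o, ξ n o ∂P0 := fun i => by
      rw [← h.law i, integral_map (h.measurable i).aemeasurable (by rw [h.law i]; exact hξm n)]
    simp only [emp, sample]
    rw [integral_const_mul, integral_finsetSum]
    · simp [hi, hn']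
    · exact fun i _ => hcomp n i
  have hempint : ∀ n : ℕ, Integrable (fun ω => emp (sample O n ω) (ξ n)) P := fun n => by
    simp only [emp, sample]
    exact (integrable_finsetSum _ fun (i : Fin n) _ => hcomp n i).const_mul _
  have hbound : ∀ n : ℕ, 1 ≤ n → P {ω | y < Real.sqrt n *
      (emp (sample O n ω) (ξ n) + ∫ o, ξ n o ∂P0)} ≤
      ENNReal.ofReal (2 * ((∫ o, χ n o ∂P0) / a) / y) := by
    intro n hn
    have hZint : Integrable (fun ω => Real.sqrt n *
        (emp (sample O n ω) (ξ n) + ∫ o, ξ n o ∂P0)) P :=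
      ((hempint n).add (integrable_const _)).const_mul _
    have hZ0 : ∀ ω, 0 ≤ Real.sqrt n * (emp (sample O n ω) (ξ n) + ∫ o, ξ n o ∂P0) := fun ω =>
      mul_nonneg (Real.sqrt_nonneg _) (add_nonneg
        (mul_nonneg (by positivity) (Finset.sum_nonneg fun _ _ => hξ0 _ _))
        (integral_nonneg (hξ0 n)))
    have hM := mul_meas_ge_le_integral_of_nonneg (ae_of_all _ hZ0) hZint y
    rw [integral_const_mul, integral_add (hempint n) (integrable_const _), hmean n hn] at hM
    simp only [integral_const, probReal_univ, smul_eq_mul, one_mul] at hM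
    refine (measure_mono (t := {ω | y ≤ Real.sqrt n *
      (emp (sample O n ω) (ξ n) + ∫ o, ξ n o ∂P0)}) fun ω hω => by
      simp only [Set.mem_ofPred_eq] at hω ⊢; exact hω.le).trans ?_
    rw [← ENNReal.ofReal_toReal (measure_ne_top P _)]
    refine ENNReal.ofReal_le_ofReal ?_
    rw [le_div_iff₀ hy, mul_comm]
    refine hM.trans ?_
    have := hle n
    linarith
  have hz : Tendsto (fun n => ENNReal.ofReal (2 * ((∫ o, χ n o ∂P0) / a) / y)) atTop (𝓝 0) := by
    have := ((hlim.div_const a).const_mul 2).div_const y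
    simpa using ENNReal.tendsto_ofReal this
  refine tendsto_of_tendsto_of_tendsto_of_le_of_le' tendsto_const_nhds hz
    (Eventually.of_forall fun _ => zero_le) ?_
  filter_upwards [eventually_ge_atTop 1] with n hn using hbound n hn

end EmpiricalProcess

/-! ### Chaining with brackets -/

section Chaining

variable {𝒪 : Type*}

lemma abs_indicator_le (f : 𝒪 → ℝ) (D : Set 𝒪) (o : 𝒪) : |D.indicator f o| ≤ |f o| := by
  simpa using norm_indicator_le_norm_self (s := D) f o

lemma abs_indicator_le_of_le {f : 𝒪 → ℝ} {D : Set 𝒪} {b : ℝ} (hb : 0 ≤ b)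
    (h : ∀ o ∈ D, |f o| ≤ b) (o : 𝒪) : |D.indicator f o| ≤ b := by
  by_cases ho : o ∈ D
  · simpa [ho] using h o ho
  · simpa [ho] using hb

lemma indicator_sub_eq_add (f l l' w : 𝒪 → ℝ) (D : Set 𝒪) (τ : ℝ) :
    (D.indicator fun o => f o - l o) = fun o => D.indicator (fun o => l' o - l o) o +
      ((D ∩ {o | τ < w o}).indicator (fun o => f o - l' o) o +
        (D ∩ {o | w o ≤ τ}).indicator (fun o => f o - l' o) o) := by
  funext o
  by_cases ho : o ∈ D
  · rcases lt_or_ge τ (w o) with ho' | ho'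
    · simp [ho, ho', not_le.2 ho']
    · simp [ho, ho', not_lt.2 ho']
  · simp [ho]

variable [MeasurableSpace 𝒪] {P0 : Measure 𝒪}

lemma memLp_indicator {f : 𝒪 → ℝ} (hf : MemLp f 2 P0) {D : Set 𝒪} (hD : NullMeasurableSet D P0) :
    MemLp (D.indicator f) 2 P0 :=
  hf.mono (hf.1.indicator₀ hD) (ae_of_all _ fun _ => norm_indicator_le_norm_self _ _)

lemma integral_sq_le {f g : 𝒪 → ℝ} (hf : MemLp f 2 P0) (hg : MemLp g 2 P0)
    (h : ∀ o, |f o| ≤ |g o|) : ∫ o, f o ^ 2 ∂P0 ≤ ∫ o, g o ^ 2 ∂P0 :=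
  integral_mono hf.integrable_sq hg.integrable_sq fun o => sq_le_sq.2 (h o)

lemma integral_sq_indicator_le {f : 𝒪 → ℝ} (hf : MemLp f 2 P0) {D : Set 𝒪}
    (hD : NullMeasurableSet D P0) : ∫ o, D.indicator f o ^ 2 ∂P0 ≤ ∫ o, f o ^ 2 ∂P0 :=
  integral_sq_le (memLp_indicator hf hD) hf (abs_indicator_le f D)

lemma integral_le_of_integral_sq_le [IsProbabilityMeasure P0] {f : 𝒪 → ℝ} (hf : MemLp f 2 P0)
    {ε : ℝ} (hε : 0 < ε) (h : ∫ o, f o ^ 2 ∂P0 ≤ ε ^ 2) : ∫ o, f o ∂P0 ≤ ε := by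
  have hI : Integrable (fun o => f o ^ 2 / (2 * ε)) P0 := hf.integrable_sq.div_const _
  have hle : ∀ o, f o ≤ f o ^ 2 / (2 * ε) + ε / 2 := fun o => by
    rw [← sub_nonneg]
    have : f o ^ 2 / (2 * ε) + ε / 2 - f o = (f o - ε) ^ 2 / (2 * ε) := by field_simp; ring
    rw [this]; positivity
  calc ∫ o, f o ∂P0 ≤ ∫ o, (f o ^ 2 / (2 * ε) + ε / 2) ∂P0 :=
        integral_mono (hf.integrable (by norm_num)) (hI.add (integrable_const _)) hle
    _ = (∫ o, f o ^ 2 ∂P0) / (2 * ε) + ε / 2 := by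
        rw [integral_add hI (integrable_const _), integral_div]; simp
    _ ≤ ε ^ 2 / (2 * ε) + ε / 2 := by gcongr
    _ = ε := by field_simp; ring

lemma integral_indicator_lt_le [IsFiniteMeasure P0] {f : 𝒪 → ℝ} (hf : MemLp f 2 P0) {D : Set 𝒪}
    (hD : NullMeasurableSet D P0) {τ v : ℝ} (hτ : 0 < τ) (hlt : ∀ o ∈ D, τ < f o)
    (h : ∫ o, f o ^ 2 ∂P0 ≤ v) : ∫ o, D.indicator f o ∂P0 ≤ v / τ := by
  have hle : ∀ o, D.indicator f o ≤ f o ^ 2 / τ := fun o => by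
    by_cases ho : o ∈ D
    · rw [Set.indicator_of_mem ho, le_div_iff₀ hτ, sq]
      exact mul_le_mul_of_nonneg_left (hlt o ho).le (hτ.trans (hlt o ho)).le
    · rw [Set.indicator_of_notMem ho]; positivity
  calc ∫ o, D.indicator f o ∂P0 ≤ ∫ o, f o ^ 2 / τ ∂P0 :=
        integral_mono ((memLp_indicator hf hD).integrable (by norm_num))
          (hf.integrable_sq.div_const _) hle
    _ = (∫ o, f o ^ 2 ∂P0) / τ := integral_div _ _
    _ ≤ v / τ := by gcongr

/-- For every `q` the class is covered by at most `exp(A² 64^q / 2)` brackets of `L²(P_0)` size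
`16^{-q}`. -/
def HasBrackets (P0 : Measure 𝒪) (A : ℝ) (𝓕 : Set (𝒪 → ℝ)) : Prop :=
  ∀ q : ℕ, ∃ B : Finset ((𝒪 → ℝ) × (𝒪 → ℝ)),
    (B.card : ℝ) ≤ Real.exp ((A * 8 ^ q) ^ 2 / 2) ∧
    (∀ b ∈ B, MemLp b.1 2 P0 ∧ MemLp b.2 2 P0 ∧ (∀ o, b.1 o ≤ b.2 o) ∧
      ∫ o, (b.2 o - b.1 o) ^ 2 ∂P0 ≤ ((1 / 16 : ℝ) ^ q) ^ 2) ∧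
    ∀ f ∈ 𝓕, ∃ b ∈ B, ∀ o, b.1 o ≤ f o ∧ f o ≤ b.2 o

/-- The truncation height for the links of the chain from level `q` to level `q + 1`: the largest
one for which the exponential inequality is sub-Gaussian at deviations `3 · 16^{-q} · A 8^{q+1}`. -/
def truncLevel (A : ℝ) (n q : ℕ) : ℝ := Real.sqrt n * (1 / 16) ^ q / (2 * (A * 8 ^ (q + 1)))

/-- A node of the chain: a bracket `[L, U]` of `L²(P_0)` size `ε`, together with the set `D` of
observations at which none of the brackets met so far is wider than its truncation height; `b` is
the last of these heights. -/
structure IsNode (P0 : Measure 𝒪) (b ε : ℝ) (x : (𝒪 → ℝ) × (𝒪 → ℝ) × Set 𝒪) : Prop where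
  memLp_lower : MemLp x.1 2 P0
  memLp_upper : MemLp x.2.1 2 P0
  nullMeasurableSet : NullMeasurableSet x.2.2 P0
  lower_le_upper : ∀ o, x.1 o ≤ x.2.1 o
  width_le : ∀ o ∈ x.2.2, x.2.1 o - x.1 o ≤ b
  integral_sq_width_le : ∫ o, (x.2.1 o - x.1 o) ^ 2 ∂P0 ≤ ε ^ 2

/-- Intersection of a node with a bracket of the next level. -/
def refineNode (b : ℝ) (x : (𝒪 → ℝ) × (𝒪 → ℝ) × Set 𝒪) (y : (𝒪 → ℝ) × (𝒪 → ℝ)) :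
    (𝒪 → ℝ) × (𝒪 → ℝ) × Set 𝒪 :=
  (fun o => max (x.1 o) (y.1 o), fun o => min (x.2.1 o) (y.2 o),
    x.2.2 ∩ {o | min (x.2.1 o) (y.2 o) - max (x.1 o) (y.1 o) ≤ b})

lemma IsNode.memLp_width {b ε : ℝ} {x : (𝒪 → ℝ) × (𝒪 → ℝ) × Set 𝒪} (hx : IsNode P0 b ε x) :
    MemLp (fun o => x.2.1 o - x.1 o) 2 P0 := hx.memLp_upper.sub hx.memLp_lower

lemma IsNode.refine {b ε b' ε' : ℝ} {x : (𝒪 → ℝ) × (𝒪 → ℝ) × Set 𝒪} (hx : IsNode P0 b ε x)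
    {y : (𝒪 → ℝ) × (𝒪 → ℝ)} (hy1 : MemLp y.1 2 P0) (hy2 : MemLp y.2 2 P0)
    (hy : ∫ o, (y.2 o - y.1 o) ^ 2 ∂P0 ≤ ε' ^ 2)
    (hle : ∀ o, max (x.1 o) (y.1 o) ≤ min (x.2.1 o) (y.2 o)) :
    IsNode P0 b' ε' (refineNode b' x y) := by
  have h1 : MemLp (fun o => max (x.1 o) (y.1 o)) 2 P0 := hx.memLp_lower.sup hy1
  have h2 : MemLp (fun o => min (x.2.1 o) (y.2 o)) 2 P0 := hx.memLp_upper.inf hy2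
  have h12 : MemLp (fun o => min (x.2.1 o) (y.2 o) - max (x.1 o) (y.1 o)) 2 P0 := h2.sub h1
  refine ⟨h1, h2, hx.nullMeasurableSet.inter
    (nullMeasurableSet_le h12.aestronglyMeasurable.aemeasurable aemeasurable_const), hle,
    fun o ho => ho.2, le_trans (integral_sq_le h12 (hy2.sub hy1) fun o => ?_) hy⟩
  have h3 := hle o
  have h4 := min_le_right (x.2.1 o) (y.2 o)
  have h5 := le_max_right (x.1 o) (y.1 o)
  change |min (x.2.1 o) (y.2 o) - max (x.1 o) (y.1 o)| ≤ |y.2 o - y.1 o|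
  rw [abs_of_nonneg (sub_nonneg.2 h3), abs_of_nonneg (by linarith)]
  linarith

lemma exp_neg_level_le {A : ℝ} (hA : 1 ≤ A) (q : ℕ) :
    Real.exp (-(A * 8 ^ q) ^ 2) ≤ (1 / 2 : ℝ) ^ q := by
  have h1 : (q : ℝ) ≤ (A * 8 ^ q) ^ 2 := by
    have h2 : (q : ℝ) ≤ 8 ^ q := by exact_mod_cast (Nat.lt_pow_self (by norm_num : 1 < 8)).le
    have h3 : (1 : ℝ) ≤ 8 ^ q := one_le_pow₀ (by norm_num)
    have h4 : (8 : ℝ) ^ q ≤ A * 8 ^ q := le_mul_of_one_le_left (by positivity) hA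
    nlinarith
  calc Real.exp (-(A * 8 ^ q) ^ 2) ≤ Real.exp (-(q : ℝ)) := Real.exp_le_exp.2 (by linarith)
    _ = Real.exp (-1) ^ q := by rw [← Real.exp_nat_mul]; congr 1; ring
    _ ≤ (1 / 2) ^ q := by
        refine pow_le_pow_left₀ (Real.exp_pos _).le ?_ q
        have := Real.exp_neg_one_lt_half
        linarith

lemma pow_sixteenth_mul_pow_eight (q : ℕ) : (1 / 16 : ℝ) ^ q * 8 ^ (q + 1) = 8 * (1 / 2) ^ q := by
  rw [pow_succ, ← mul_assoc, ← mul_pow]; norm_num; ring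

variable {Ω : Type*} [MeasurableSpace Ω] {P : Measure Ω} {O : ℕ → Ω → 𝒪} {n : ℕ}
  [IsProbabilityMeasure P] [IsProbabilityMeasure P0]

/-- The remainder of the chain beyond level `q`, by induction from the last level `Q` downwards.
At level `Q`, where `√n ≤ 8^Q`, the bracket width alone is small enough. Passing from `q` to `q + 1`,
the link `L' - L` and the part of the remainder where the refined bracket is too wide for the next
level are bounded by the exponential inequality. -/
lemma IsIIDSample.measure_chain_remainder (h : IsIIDSample P P0 O) (hn : 1 ≤ n) {A : ℝ}
    (hA : 1 ≤ A) {𝓕 : Set (𝒪 → ℝ)} (h𝓕 : ∀ f ∈ 𝓕, MemLp f 2 P0) (hB : HasBrackets P0 A 𝓕) {Q : ℕ}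
    (hQ : Real.sqrt n ≤ 8 ^ Q) (j : ℕ) : ∀ (q : ℕ), q + j = Q →
    ∀ S : Finset ((𝒪 → ℝ) × (𝒪 → ℝ) × Set 𝒪), (S.card : ℝ) ≤ Real.exp ((A * 8 ^ q) ^ 2) →
      (∀ x ∈ S, IsNode P0 (truncLevel A n q) ((1 / 16) ^ q) x) →
      P {ω | ∃ f ∈ 𝓕, ∃ x ∈ S, (∀ o, x.1 o ≤ f o ∧ f o ≤ x.2.1 o) ∧
        128 * A * (1 / 2) ^ q < |centredEmp P0 O n (x.2.2.indicator fun o => f o - x.1 o) ω|} ≤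
        ENNReal.ofReal (4 * (1 / 2) ^ q) := by
  classical
  have hn' : (0 : ℝ) < n := by exact_mod_cast hn
  have hsn : 0 < Real.sqrt n := Real.sqrt_pos.2 hn'
  have hA0 : 0 < A := by linarith
  have hτ : ∀ q, 0 < truncLevel A n q := fun q => by unfold truncLevel; positivity
  have hdev : ∀ q : ℕ, 3 * (1 / 16 : ℝ) ^ q * (A * 8 ^ (q + 1)) = 24 * A * (1 / 2) ^ q := fun q => by
    have := pow_sixteenth_mul_pow_eight q
    calc _ = 3 * A * ((1 / 16 : ℝ) ^ q * 8 ^ (q + 1)) := by ring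
      _ = _ := by rw [this]; ring
  have hcardmono : ∀ q : ℕ, (A * 8 ^ (q + 1)) ^ 2 = 64 * (A * 8 ^ q) ^ 2 := fun q => by
    rw [pow_succ]; ring
  induction j with
  | zero =>
    intro q hq S hcard hS
    obtain rfl : q = Q := by omega
    have hE := h.measure_exists_lt_abs_centredEmp hn S
      (ξ := fun x => x.2.2.indicator fun o => x.2.1 o - x.1 o)
      (σ := (1 / 16) ^ q) (s := A * 8 ^ (q + 1)) (by positivity) (by positivity)
      (hcard.trans (Real.exp_le_exp.2 (by rw [hcardmono]; nlinarith [sq_nonneg (A * 8 ^ q)])))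
      (fun x hx => (memLp_indicator (hS x hx).memLp_width (hS x hx).nullMeasurableSet).1)
      (fun x hx => abs_indicator_le_of_le (hτ q).le fun o ho => by
        rw [abs_of_nonneg (sub_nonneg.2 ((hS x hx).lower_le_upper o))]
        exact (hS x hx).width_le o ho)
      (fun x hx => (integral_sq_indicator_le (hS x hx).memLp_width
        (hS x hx).nullMeasurableSet).trans (hS x hx).integral_sq_width_le)
    refine (measure_mono ?_).trans (hE.trans ?_)
    · rintro ω ⟨f, hf, x, hx, hfx, hlt⟩
      refine ⟨x, hx, ?_⟩
      have hxS := hS x hx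
      have hbd := abs_centredEmp_le_of_nonneg (P0 := P0) (O := O) (n := n)
        (ξ := x.2.2.indicator fun o => f o - x.1 o)
        (ψ := x.2.2.indicator fun o => x.2.1 o - x.1 o)
        (fun o => Set.indicator_nonneg (fun o _ => sub_nonneg.2 (hfx o).1) o)
        (fun o => Set.indicator_le_indicator (by linarith [(hfx o).2]))
        ((memLp_indicator ((h𝓕 f hf).sub hxS.memLp_lower) hxS.nullMeasurableSet).integrable
          (by norm_num))
        ((memLp_indicator hxS.memLp_width hxS.nullMeasurableSet).integrable (by norm_num)) ω
      have hmean : ∫ o, x.2.2.indicator (fun o => x.2.1 o - x.1 o) o ∂P0 ≤ (1 / 16) ^ q :=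
        integral_le_of_integral_sq_le (memLp_indicator hxS.memLp_width hxS.nullMeasurableSet)
          (by positivity) ((integral_sq_indicator_le hxS.memLp_width
            hxS.nullMeasurableSet).trans hxS.integral_sq_width_le)
      have h1 : Real.sqrt n * ∫ o, x.2.2.indicator (fun o => x.2.1 o - x.1 o) o ∂P0 ≤
          8 ^ q * (1 / 16) ^ q :=
        mul_le_mul hQ hmean (integral_nonneg fun o => Set.indicator_nonneg
          (fun o _ => sub_nonneg.2 (hxS.lower_le_upper o)) o) (by positivity)
      rw [← mul_pow, show (8 * (1 / 16) : ℝ) = 1 / 2 by norm_num] at h1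
      rw [hdev]
      have h2 : (0 : ℝ) < (1 / 2) ^ q := by positivity
      nlinarith
    · rw [← ENNReal.ofReal_ofNat, ← ENNReal.ofReal_mul (by norm_num)]
      refine ENNReal.ofReal_le_ofReal ?_
      have h1 := exp_neg_level_le hA (q + 1)
      have h2 : (0 : ℝ) < (1 / 2) ^ q := by positivity
      rw [pow_succ (1 / 2 : ℝ)] at h1
      linarith
  | succ j ih =>
    intro q hq S hcard hS
    obtain ⟨B, hBcard, hBmem, hBcov⟩ := hB (q + 1)
    set T := (S ×ˢ B).filter fun p => ∀ o, max (p.1.1 o) (p.2.1 o) ≤ min (p.1.2.1 o) (p.2.2 o)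
      with hT
    set S' := T.image fun p => refineNode (truncLevel A n (q + 1)) p.1 p.2 with hS'
    have hTcard : (T.card : ℝ) ≤ Real.exp ((A * 8 ^ (q + 1)) ^ 2) := by
      calc (T.card : ℝ) ≤ ((S ×ˢ B).card : ℝ) := by
            exact_mod_cast Finset.card_le_card (Finset.filter_subset _ _)
        _ = S.card * B.card := by rw [Finset.card_product, Nat.cast_mul]
        _ ≤ Real.exp ((A * 8 ^ q) ^ 2) * Real.exp ((A * 8 ^ (q + 1)) ^ 2 / 2) := by gcongr
        _ = Real.exp ((A * 8 ^ q) ^ 2 + (A * 8 ^ (q + 1)) ^ 2 / 2) := (Real.exp_add _ _).symm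
        _ ≤ _ := Real.exp_le_exp.2 (by rw [hcardmono]; nlinarith [sq_nonneg (A * 8 ^ q)])
    have hS'card : (S'.card : ℝ) ≤ Real.exp ((A * 8 ^ (q + 1)) ^ 2) :=
      le_trans (by exact_mod_cast Finset.card_image_le) hTcard
    have hTnode : ∀ p ∈ T, IsNode P0 (truncLevel A n q) ((1 / 16) ^ q) p.1 ∧
        IsNode P0 (truncLevel A n (q + 1)) ((1 / 16) ^ (q + 1))
          (refineNode (truncLevel A n (q + 1)) p.1 p.2) := fun p hp => by
      have hp' := Finset.mem_filter.1 hp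
      have hpp := Finset.mem_product.1 hp'.1
      obtain ⟨hb1, hb2, -, hb3⟩ := hBmem p.2 hpp.2
      exact ⟨hS p.1 hpp.1, (hS p.1 hpp.1).refine hb1 hb2 hb3 hp'.2⟩
    have hS'node : ∀ x ∈ S', IsNode P0 (truncLevel A n (q + 1)) ((1 / 16) ^ (q + 1)) x := by
      intro x hx
      obtain ⟨p, hp, rfl⟩ := Finset.mem_image.1 hx
      exact (hTnode p hp).2
    -- the lower end, the width and the exceptional set of the refined bracket
    let L' : ((𝒪 → ℝ) × (𝒪 → ℝ) × Set 𝒪) × ((𝒪 → ℝ) × (𝒪 → ℝ)) → 𝒪 → ℝ :=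
      fun p o => max (p.1.1 o) (p.2.1 o)
    let W' : ((𝒪 → ℝ) × (𝒪 → ℝ) × Set 𝒪) × ((𝒪 → ℝ) × (𝒪 → ℝ)) → 𝒪 → ℝ :=
      fun p o => min (p.1.2.1 o) (p.2.2 o) - max (p.1.1 o) (p.2.1 o)
    let X' : ((𝒪 → ℝ) × (𝒪 → ℝ) × Set 𝒪) × ((𝒪 → ℝ) × (𝒪 → ℝ)) → Set 𝒪 :=
      fun p => p.1.2.2 ∩ {o | truncLevel A n (q + 1) < W' p o}
    have hL'm : ∀ p ∈ T, MemLp (fun o => L' p o - p.1.1 o) 2 P0 := fun p hp =>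
      (hTnode p hp).2.memLp_lower.sub (hTnode p hp).1.memLp_lower
    have hW'm : ∀ p ∈ T, MemLp (W' p) 2 P0 := fun p hp => (hTnode p hp).2.memLp_width
    have hX'm : ∀ p ∈ T, NullMeasurableSet (X' p) P0 := fun p hp =>
      (hTnode p hp).1.nullMeasurableSet.inter
        (nullMeasurableSet_lt aemeasurable_const (hW'm p hp).1.aemeasurable)
    have hL'bd : ∀ p ∈ T, ∀ o, |L' p o - p.1.1 o| ≤ p.1.2.1 o - p.1.1 o := fun p hp o => by
      have h1 := (hTnode p hp).2.lower_le_upper o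
      have h2 : L' p o ≤ p.1.2.1 o := h1.trans (min_le_left _ _)
      rw [abs_of_nonneg (sub_nonneg.2 (le_max_left _ _))]
      linarith
    have hW'bd : ∀ p ∈ T, ∀ o, 0 ≤ W' p o ∧ W' p o ≤ p.1.2.1 o - p.1.1 o := fun p hp o =>
      ⟨sub_nonneg.2 ((hTnode p hp).2.lower_le_upper o),
        sub_le_sub (min_le_left _ _) (le_max_left _ _)⟩
    have hE1 := h.measure_exists_lt_abs_centredEmp hn T
      (ξ := fun p => p.1.2.2.indicator fun o => L' p o - p.1.1 o)
      (σ := (1 / 16) ^ q) (s := A * 8 ^ (q + 1)) (by positivity) (by positivity) hTcard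
      (fun p hp => (memLp_indicator (hL'm p hp) (hTnode p hp).1.nullMeasurableSet).1)
      (fun p hp => abs_indicator_le_of_le (hτ q).le fun o ho =>
        (hL'bd p hp o).trans ((hTnode p hp).1.width_le o ho))
      (fun p hp => ((integral_sq_indicator_le (hL'm p hp)
        (hTnode p hp).1.nullMeasurableSet).trans (integral_sq_le (hL'm p hp)
          (hTnode p hp).1.memLp_width fun o => (hL'bd p hp o).trans (le_abs_self _))).trans
            (hTnode p hp).1.integral_sq_width_le)
    have hE2 := h.measure_exists_lt_abs_centredEmp hn T
      (ξ := fun p => (X' p).indicator (W' p))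
      (σ := (1 / 16) ^ q) (s := A * 8 ^ (q + 1)) (by positivity) (by positivity) hTcard
      (fun p hp => (memLp_indicator (hW'm p hp) (hX'm p hp)).1)
      (fun p hp => abs_indicator_le_of_le (hτ q).le fun o ho => by
        rw [abs_of_nonneg (hW'bd p hp o).1]
        exact (hW'bd p hp o).2.trans ((hTnode p hp).1.width_le o ho.1))
      (fun p hp => ((integral_sq_indicator_le (hW'm p hp) (hX'm p hp)).trans
        (integral_sq_le (hW'm p hp) (hTnode p hp).1.memLp_width fun o => by
          rw [abs_of_nonneg (hW'bd p hp o).1]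
          exact (hW'bd p hp o).2.trans (le_abs_self _))).trans
            (hTnode p hp).1.integral_sq_width_le)
    have hE3 := ih (q + 1) (by omega) S' hS'card hS'node
    refine (measure_mono (t := _ ∪ (_ ∪ _)) ?_).trans ((measure_union_le _ _).trans
      ((add_le_add hE3 ((measure_union_le _ _).trans (add_le_add hE1 hE2))).trans ?_))
    · rintro ω ⟨f, hf, x, hx, hfx, hlt⟩
      by_contra hω
      simp only [Set.mem_union, Set.mem_ofPred_eq, not_or, not_exists, not_and, not_lt] at hω
      obtain ⟨h3, h1, h2⟩ := hω
      obtain ⟨y, hy, hfy⟩ := hBcov f hf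
      have hpT : (x, y) ∈ T := Finset.mem_filter.2 ⟨Finset.mem_product.2 ⟨hx, hy⟩, fun o =>
        (max_le (hfx o).1 (hfy o).1).trans (le_min (hfx o).2 (hfy o).2)⟩
      have hN := hTnode _ hpT
      have hfint : ∀ (l : 𝒪 → ℝ) (D : Set 𝒪), MemLp l 2 P0 → NullMeasurableSet D P0 →
          Integrable (D.indicator fun o => f o - l o) P0 := fun l D hl hD =>
        (memLp_indicator ((h𝓕 f hf).sub hl) hD).integrable (by norm_num)
      have hsplit : (x.2.2.indicator fun o => f o - x.1 o) = fun o =>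
          x.2.2.indicator (fun o => L' (x, y) o - x.1 o) o +
          ((X' (x, y)).indicator (fun o => f o - L' (x, y) o) o +
          (refineNode (truncLevel A n (q + 1)) x y).2.2.indicator
            (fun o => f o - (refineNode (truncLevel A n (q + 1)) x y).1 o) o) :=
        indicator_sub_eq_add f x.1 (L' (x, y)) (W' (x, y)) x.2.2 _
      have hI2 : Integrable ((X' (x, y)).indicator fun o => f o - L' (x, y) o) P0 :=
        hfint _ _ hN.2.memLp_lower (hX'm _ hpT)
      have hI3 : Integrable ((refineNode (truncLevel A n (q + 1)) x y).2.2.indicator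
          fun o => f o - (refineNode (truncLevel A n (q + 1)) x y).1 o) P0 :=
        hfint _ _ hN.2.memLp_lower hN.2.nullMeasurableSet
      have hI23 : Integrable (fun o => (X' (x, y)).indicator (fun o => f o - L' (x, y) o) o +
          (refineNode (truncLevel A n (q + 1)) x y).2.2.indicator
            (fun o => f o - (refineNode (truncLevel A n (q + 1)) x y).1 o) o) P0 := hI2.add hI3
      have hI1 : Integrable (x.2.2.indicator fun o => L' (x, y) o - x.1 o) P0 :=
        (memLp_indicator (hL'm _ hpT) hN.1.nullMeasurableSet).integrable (by norm_num)
      have hlow : ∀ o, L' (x, y) o ≤ f o := fun o => max_le (hfx o).1 (hfy o).1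
      have hup : ∀ o, f o - L' (x, y) o ≤ W' (x, y) o := fun o =>
        sub_le_sub_right (le_min (hfx o).2 (hfy o).2) _
      rw [hsplit, centredEmp_add hI1 hI23, centredEmp_add hI2 hI3] at hlt
      have hb1 := h1 _ hpT
      have hb2 := h2 _ hpT
      have hb3 := h3 f hf _ (Finset.mem_image_of_mem _ hpT)
        (fun o => ⟨hlow o, le_min (hfx o).2 (hfy o).2⟩)
      have hb2' := abs_centredEmp_le_of_nonneg (P0 := P0) (O := O) (n := n)
        (ξ := (X' (x, y)).indicator fun o => f o - L' (x, y) o)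
        (ψ := (X' (x, y)).indicator (W' (x, y)))
        (fun o => Set.indicator_nonneg (fun o _ => sub_nonneg.2 (hlow o)) o)
        (fun o => Set.indicator_le_indicator (hup o)) hI2
        ((memLp_indicator (hW'm _ hpT) (hX'm _ hpT)).integrable (by norm_num)) ω
      have hmean : ∫ o, (X' (x, y)).indicator (W' (x, y)) o ∂P0 ≤
          ((1 / 16) ^ (q + 1)) ^ 2 / truncLevel A n (q + 1) :=
        integral_indicator_lt_le (hW'm _ hpT) (hX'm _ hpT) (hτ _) (fun o ho => ho.2)
          hN.2.integral_sq_width_le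
      have hmean' : Real.sqrt n * ∫ o, (X' (x, y)).indicator (W' (x, y)) o ∂P0 ≤
          8 * A * (1 / 2) ^ q := by
        refine (mul_le_mul_of_nonneg_left hmean hsn.le).trans (le_of_eq ?_)
        have := pow_sixteenth_mul_pow_eight (q + 1)
        calc Real.sqrt n * (((1 / 16) ^ (q + 1)) ^ 2 / truncLevel A n (q + 1))
            = 2 * A * ((1 / 16) ^ (q + 1) * 8 ^ (q + 1 + 1)) := by
              rw [truncLevel]; field_simp
          _ = 8 * A * (1 / 2) ^ q := by rw [this]; ring
      rw [hdev] at hb1 hb2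
      rw [pow_succ (1 / 2 : ℝ)] at hb3
      have ht := (abs_add_le (centredEmp P0 O n (x.2.2.indicator fun o => L' (x, y) o - x.1 o) ω)
        (centredEmp P0 O n ((X' (x, y)).indicator fun o => f o - L' (x, y) o) ω +
          centredEmp P0 O n ((refineNode (truncLevel A n (q + 1)) x y).2.2.indicator
            fun o => f o - (refineNode (truncLevel A n (q + 1)) x y).1 o) ω))
      have ht' := abs_add_le
        (centredEmp P0 O n ((X' (x, y)).indicator fun o => f o - L' (x, y) o) ω)
        (centredEmp P0 O n ((refineNode (truncLevel A n (q + 1)) x y).2.2.indicator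
            fun o => f o - (refineNode (truncLevel A n (q + 1)) x y).1 o) ω)
      have hlt' := hlt.trans_le (ht.trans (add_le_add_right ht' _))
      linarith
    · rw [← ENNReal.ofReal_ofNat, ← ENNReal.ofReal_mul (by norm_num),
        ← ENNReal.ofReal_add (by positivity) (by positivity),
        ← ENNReal.ofReal_add (by positivity) (by positivity)]
      refine ENNReal.ofReal_le_ofReal ?_
      have h1 := exp_neg_level_le hA (q + 1)
      rw [pow_succ (1 / 2 : ℝ)] at h1 ⊢
      linarith

end Chaining

/-! ### Asymptotic equicontinuity under bracketing entropy -/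

section Equicontinuity

variable {𝒪 : Type*} [MeasurableSpace 𝒪] {P0 : Measure 𝒪}

lemma integral_sq_le_of_eLpNorm_le {f : 𝒪 → ℝ} (hf : MemLp f 2 P0) {ε : ℝ} (hε : 0 ≤ ε)
    (h : eLpNorm f 2 P0 ≤ ENNReal.ofReal ε) : ∫ o, f o ^ 2 ∂P0 ≤ ε ^ 2 := by
  have h0 : 0 ≤ ∫ o, f o ^ 2 ∂P0 := integral_nonneg fun o => sq_nonneg _
  rw [hf.eLpNorm_eq_integral_rpow_norm (by norm_num) (by norm_num)] at h
  have h1 := (ENNReal.ofReal_le_ofReal_iff hε).1 h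
  have h2 : ∫ o, ‖f o‖ ^ (2 : ℝ≥0∞).toReal ∂P0 = ∫ o, f o ^ 2 ∂P0 := by simp
  rw [h2] at h1
  have h3 : (∫ o, f o ^ 2 ∂P0) = ((∫ o, f o ^ 2 ∂P0) ^ ((2 : ℝ≥0∞).toReal⁻¹)) ^ 2 := by
    rw [← Real.rpow_natCast, ← Real.rpow_mul h0]; simp
  rw [h3]
  exact pow_le_pow_left₀ (Real.rpow_nonneg h0 _) h1 2

lemma exists_pow_le_mul_pow (c : ℝ) (hc : 0 ≤ c) (q : ℕ) :
    ∃ C : ℝ, 0 ≤ C ∧ ∀ j : ℕ, (1 + j * c) ^ q ≤ C * 4 ^ j := by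
  have ht := tendsto_pow_const_div_const_pow_of_one_lt q (show (1 : ℝ) < 4 by norm_num)
  obtain ⟨C, hC⟩ := ht.bddAbove_range
  have hC0 : 0 ≤ C := le_trans (by positivity) (hC ⟨0, rfl⟩)
  refine ⟨(1 + c) ^ q * (C * 4), by positivity, fun j => ?_⟩
  have h1 := hC ⟨j + 1, rfl⟩
  simp only at h1
  rw [div_le_iff₀ (by positivity)] at h1
  push_cast at h1
  calc (1 + j * c) ^ q ≤ ((1 + c) * (j + 1)) ^ q := by
        refine pow_le_pow_left₀ (by positivity) ?_ q
        nlinarith [(Nat.cast_nonneg j : (0 : ℝ) ≤ j)]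
    _ = (1 + c) ^ q * ((j : ℝ) + 1) ^ q := mul_pow _ _ _
    _ ≤ (1 + c) ^ q * (C * 4 ^ (j + 1)) := by gcongr
    _ = _ := by ring

/-- The entropy bound has exponent `1 / (k + 1) ≤ 1` up to logarithms, which leaves room below the
critical exponent `2`; the levels `16^{-q}` and the exponent `3 / 2` keep the constants integral. -/
lemma EntropyBound.hasBrackets {k : ℕ} {𝓕 : Set (𝒪 → ℝ)} (h : EntropyBound P0 k 𝓕) :
    ∃ A : ℝ, 1 ≤ A ∧ HasBrackets P0 A 𝓕 := by
  classical
  obtain ⟨K, q, hE⟩ := h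
  obtain ⟨C, hC0, hC⟩ := exists_pow_le_mul_pow (Real.log 16) (Real.log_nonneg (by norm_num)) q
  have hKC : 0 ≤ |K| * C := by positivity
  refine ⟨1 + 2 * (|K| * C), by linarith, fun j => ?_⟩
  obtain ⟨B, hB1, hB2, hB3⟩ := hE ((1 / 16) ^ j) (by positivity)
    (pow_le_one₀ (by norm_num) (by norm_num))
  refine ⟨B.filter fun b => ∀ o, b.1 o ≤ b.2 o, ?_, fun b hb => ?_, fun f hf => ?_⟩
  · have hlog : Real.log (B.card : ℝ) ≤ ((1 + 2 * (|K| * C)) * 8 ^ j) ^ 2 / 2 := by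
      refine hB1.trans ?_
      have h16 : (1 : ℝ) ≤ 16 ^ j := one_le_pow₀ (by norm_num)
      have hr : ((1 / 16 : ℝ) ^ j) ^ (-(1 / ((k : ℝ) + 1))) ≤ 16 ^ j := by
        have hk : (1 : ℝ) / ((k : ℝ) + 1) ≤ 1 := by
          rw [div_le_one (by positivity)]; linarith [(Nat.cast_nonneg k : (0 : ℝ) ≤ k)]
        rw [one_div_pow, one_div ((16 : ℝ) ^ j), Real.inv_rpow (by positivity),
          Real.rpow_neg (by positivity), inv_inv]
        exact (Real.rpow_le_rpow_of_exponent_le h16 hk).trans (le_of_eq (Real.rpow_one _))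
      have hl : 1 + Real.log (1 / (1 / 16 : ℝ) ^ j) = 1 + j * Real.log 16 := by
        rw [one_div_pow, one_div_one_div, Real.log_pow]
      have hl0 : 0 ≤ 1 + j * Real.log 16 := by
        have := Real.log_nonneg (show (1 : ℝ) ≤ 16 by norm_num)
        positivity
      rw [hl]
      calc K * ((1 / 16 : ℝ) ^ j) ^ (-(1 / ((k : ℝ) + 1))) * (1 + j * Real.log 16) ^ q
          ≤ |K| * 16 ^ j * (C * 4 ^ j) := by
            refine mul_le_mul (mul_le_mul (le_abs_self K) hr (by positivity) (abs_nonneg K)) (hC j)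
              (pow_nonneg hl0 q) (by positivity)
        _ = |K| * C * 64 ^ j := by
            rw [show (64 : ℝ) = 16 * 4 by norm_num, mul_pow]; ring
        _ ≤ (1 + 2 * (|K| * C)) ^ 2 / 2 * 64 ^ j := by
            gcongr
            nlinarith
        _ = _ := by rw [show (64 : ℝ) = 8 ^ 2 by norm_num, ← pow_mul, mul_comm 2 j, pow_mul]; ring
    refine le_trans (Nat.cast_le.2 (Finset.card_le_card (Finset.filter_subset _ B))) ?_
    rcases Nat.eq_zero_or_pos B.card with h0 | h0
    · rw [h0]; simp [Real.exp_nonneg]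
    · rwa [← Real.log_le_iff_le_exp (by exact_mod_cast h0)]
  · obtain ⟨hb, hle⟩ := Finset.mem_filter.1 hb
    obtain ⟨h1, h2, h3⟩ := hB2 b hb
    exact ⟨h1, h2, hle, integral_sq_le_of_eLpNorm_le (h2.sub h1) (by positivity) h3⟩
  · obtain ⟨b, hb, hfb⟩ := hB3 f hf
    exact ⟨b, Finset.mem_filter.2 ⟨hb, fun o => (hfb o).1.trans (hfb o).2⟩, hfb⟩

lemma HasBrackets.memLp {A : ℝ} {𝓕 : Set (𝒪 → ℝ)} (h : HasBrackets P0 A 𝓕) {f : 𝒪 → ℝ} (hf : f ∈ 𝓕)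
    (hm : AEStronglyMeasurable f P0) : MemLp f 2 P0 := by
  obtain ⟨B, -, hB2, hB3⟩ := h 0
  obtain ⟨b, hb, hfb⟩ := hB3 f hf
  obtain ⟨h1, h2, -, -⟩ := hB2 b hb
  refine (h1.norm.add h2.norm).mono hm (ae_of_all _ fun o => ?_)
  simp only [Pi.add_apply, Real.norm_eq_abs]
  rw [abs_of_nonneg (add_nonneg (abs_nonneg (b.1 o)) (abs_nonneg (b.2 o))), abs_le]
  have h3 := (abs_le.1 (le_refl |b.1 o|)).1
  have h4 := le_abs_self (b.2 o)
  constructor <;> linarith [(hfb o).1, (hfb o).2, abs_nonneg (b.1 o), abs_nonneg (b.2 o)]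

variable {Ω : Type*} [MeasurableSpace Ω] {P : Measure Ω} {O : ℕ → Ω → 𝒪}
  [IsProbabilityMeasure P] [IsProbabilityMeasure P0]

/-- Asymptotic equicontinuity: over the members of the class with small `L²(P_0)` norm the empirical
process is uniformly small, up to small outer probability. -/
theorem IsIIDSample.equicontinuous (h : IsIIDSample P P0 O) {A : ℝ} (hA : 1 ≤ A)
    {𝓕 : Set (𝒪 → ℝ)} (h𝓕 : ∀ f ∈ 𝓕, MemLp f 2 P0) (hB : HasBrackets P0 A 𝓕) {x : ℝ} (hx : 0 < x)
    {η : ℝ≥0∞} (hη : 0 < η) :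
    ∃ δ : ℝ, 0 < δ ∧ ∀ᶠ n : ℕ in atTop,
      P {ω | ∃ f ∈ 𝓕, ∫ o, f o ^ 2 ∂P0 ≤ δ ^ 2 ∧ x < |centredEmp P0 O n f ω|} ≤ η := by
  classical
  have hA0 : 0 < A := by linarith
  have hη2 : 0 < η / 2 := ENNReal.div_pos hη.ne' (by norm_num)
  have hpow : Tendsto (fun q : ℕ => (1 / 2 : ℝ) ^ q) atTop (𝓝 0) :=
    tendsto_pow_atTop_nhds_zero_of_lt_one (by norm_num) (by norm_num)
  obtain ⟨q, hq1, hq2⟩ : ∃ q : ℕ, 176 * A * (1 / 2) ^ q < x / 2 ∧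
      ENNReal.ofReal (6 * (1 / 2) ^ q) < η / 2 := by
    have h1 : Tendsto (fun q : ℕ => 176 * A * (1 / 2 : ℝ) ^ q) atTop (𝓝 0) := by
      simpa using hpow.const_mul (176 * A)
    have h2 : Tendsto (fun q : ℕ => ENNReal.ofReal (6 * (1 / 2 : ℝ) ^ q)) atTop (𝓝 0) := by
      simpa using ENNReal.tendsto_ofReal (hpow.const_mul 6)
    exact ((h1.eventually_lt_const (by positivity)).and (h2.eventually_lt_const hη2)).exists
  obtain ⟨B, hBcard, hBmem, hBcov⟩ := hB q
  set a : ℝ := (1 / 16) ^ q / (2 * (A * 8 ^ (q + 1))) with ha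
  have ha0 : 0 < a := by positivity
  have hτ : ∀ n : ℕ, truncLevel A n q = Real.sqrt n * a := fun n => by
    rw [truncLevel, ha, mul_div_assoc]
  -- the event on which the part of `ψ` above the truncation height is not negligible
  let tail : (𝒪 → ℝ) → ℕ → Set Ω := fun ψ n => {ω | x / 4 < Real.sqrt n *
      (emp (sample O n ω) ({o | Real.sqrt n * a < |ψ o|}.indicator fun o => |ψ o|) +
        ∫ o, {o | Real.sqrt n * a < |ψ o|}.indicator (fun o => |ψ o|) o ∂P0)}
  have htail : Tendsto (fun n => ∑ b ∈ B, (P (tail b.1 n) + P (tail (b.2 - b.1) n)))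
      atTop (𝓝 0) := by
    have : Tendsto (fun n => ∑ b ∈ B, (P (tail b.1 n) + P (tail (b.2 - b.1) n)))
        atTop (𝓝 (∑ b ∈ B, (0 + 0))) :=
      tendsto_finsetSum _ fun b hb =>
        (h.tendsto_measure_tail (hBmem b hb).1 ha0 (by positivity)).add
          (h.tendsto_measure_tail ((hBmem b hb).2.1.sub (hBmem b hb).1) ha0 (by positivity))
    simpa using this
  have htail_le : ∀ ψ : 𝒪 → ℝ, MemLp ψ 2 P0 → ∀ (n : ℕ) (ω : Ω), ω ∉ tail ψ n →
      ∀ f : 𝒪 → ℝ, (∀ o, |f o| ≤ {o | Real.sqrt n * a < |ψ o|}.indicator (fun o => |ψ o|) o) →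
        |centredEmp P0 O n f ω| ≤ x / 4 := by
    intro ψ hψ n ω hω f hf
    refine (abs_centredEmp_le hf ?_ ω).trans (not_lt.1 hω)
    exact (memLp_indicator hψ.norm (nullMeasurableSet_lt aemeasurable_const
      hψ.norm.1.aemeasurable)).integrable (by norm_num)
  refine ⟨(1 / 16) ^ q, by positivity, ?_⟩
  filter_upwards [eventually_ge_atTop 1, htail.eventually_lt_const hη2] with n hn hn2
  have hB0 : ∀ b ∈ B, ∀ o, 0 ≤ b.2 o - b.1 o := fun b hb o => sub_nonneg.2 ((hBmem b hb).2.2.1 o)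
  -- remainder of the chain started at the brackets of level `q`
  set S := B.image fun b : (𝒪 → ℝ) × (𝒪 → ℝ) =>
    (b.1, b.2, {o | b.2 o - b.1 o ≤ truncLevel A n q}) with hS
  have hcard' : (B.card : ℝ) ≤ Real.exp ((A * 8 ^ q) ^ 2) :=
    hBcard.trans (Real.exp_le_exp.2 (by linarith [sq_nonneg (A * 8 ^ q)]))
  have hE1 := h.measure_chain_remainder hn hA h𝓕 hB (Q := q + n) (j := n)
    (by
      have h1 : Real.sqrt n ≤ n :=
        (Real.sqrt_le_left (Nat.cast_nonneg n)).2 (by exact_mod_cast Nat.le_self_pow two_ne_zero n)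
      have h2 : (n : ℝ) ≤ 8 ^ n := by exact_mod_cast (Nat.lt_pow_self (by norm_num : 1 < 8)).le
      have h3 : (8 : ℝ) ^ n ≤ 8 ^ (q + n) := pow_le_pow_right₀ (by norm_num) (by omega)
      linarith) q rfl S
    (le_trans (by exact_mod_cast Finset.card_image_le) hcard') (by
      intro y hy
      obtain ⟨b, hb, rfl⟩ := Finset.mem_image.1 hy
      obtain ⟨h1, h2, h3, h4⟩ := hBmem b hb
      exact ⟨h1, h2, nullMeasurableSet_le (h2.sub h1).1.aemeasurable aemeasurable_const, h3,
        fun o ho => ho, h4⟩)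
  -- truncated lower ends of the brackets
  have hE2 := h.measure_exists_lt_abs_centredEmp hn
    (B.filter fun b => ∫ o, b.1 o ^ 2 ∂P0 ≤ (2 * (1 / 16) ^ q) ^ 2)
    (ξ := fun b => {o | |b.1 o| ≤ truncLevel A n q}.indicator b.1)
    (σ := 2 * (1 / 16) ^ q) (s := A * 8 ^ (q + 1)) (by positivity) (by positivity)
    (by
      refine le_trans ?_ (hcard'.trans (Real.exp_le_exp.2 ?_))
      · exact_mod_cast Finset.card_le_card (Finset.filter_subset _ _)
      · rw [pow_succ 8]; nlinarith [sq_nonneg (A * 8 ^ q)])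
    (fun b hb => (memLp_indicator (hBmem b (Finset.mem_filter.1 hb).1).1 (nullMeasurableSet_le
      (hBmem b (Finset.mem_filter.1 hb).1).1.norm.1.aemeasurable aemeasurable_const)).1)
    (fun b hb => abs_indicator_le_of_le (by positivity) fun o ho => by
      refine le_trans ho ?_
      rw [truncLevel]
      gcongr
      have : (0 : ℝ) < (1 / 16) ^ q := by positivity
      linarith)
    (fun b hb => (integral_sq_indicator_le (hBmem b (Finset.mem_filter.1 hb).1).1
      (nullMeasurableSet_le (hBmem b (Finset.mem_filter.1 hb).1).1.norm.1.aemeasurable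
        aemeasurable_const)).trans (Finset.mem_filter.1 hb).2)
  have hE3 : P (⋃ b ∈ B, (tail b.1 n ∪ tail (b.2 - b.1) n)) ≤ η / 2 :=
    ((measure_biUnion_finset_le _ _).trans (Finset.sum_le_sum fun b _ =>
      measure_union_le _ _)).trans hn2.le
  refine (measure_mono (t := (_ ∪ _) ∪ _) ?_).trans ((measure_union_le _ _).trans
    ((add_le_add ((measure_union_le _ _).trans (add_le_add hE1 hE2)) hE3).trans ?_))
  · rintro ω ⟨f, hf, hf2, hlt⟩
    by_contra hω
    simp only [Set.mem_union, Set.mem_ofPred_eq, not_or, not_exists, not_and, not_lt,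
      Set.mem_iUnion] at hω
    obtain ⟨⟨h1, h2⟩, h3⟩ := hω
    obtain ⟨b, hb, hfb⟩ := hBcov f hf
    obtain ⟨hl, hu, hle, hw⟩ := hBmem b hb
    have hfl : MemLp (fun o => f o - b.1 o) 2 P0 := (h𝓕 f hf).sub hl
    have hl2 : ∫ o, b.1 o ^ 2 ∂P0 ≤ (2 * (1 / 16) ^ q) ^ 2 := by
      have hw' : ∫ o, (f o - b.1 o) ^ 2 ∂P0 ≤ ((1 / 16) ^ q) ^ 2 :=
        (integral_sq_le hfl (hu.sub hl) fun o => by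
          rw [abs_of_nonneg (sub_nonneg.2 (hfb o).1), Pi.sub_apply, abs_of_nonneg (hB0 b hb o)]
          linarith [(hfb o).2]).trans hw
      have hi1 : Integrable (fun o => 2 * f o ^ 2) P0 := (h𝓕 f hf).integrable_sq.const_mul 2
      have hi2 : Integrable (fun o => 2 * (f o - b.1 o) ^ 2) P0 := hfl.integrable_sq.const_mul 2
      calc ∫ o, b.1 o ^ 2 ∂P0 ≤ ∫ o, (2 * f o ^ 2 + 2 * (f o - b.1 o) ^ 2) ∂P0 :=
            integral_mono hl.integrable_sq (hi1.add hi2) fun o => by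
              change b.1 o ^ 2 ≤ 2 * f o ^ 2 + 2 * (f o - b.1 o) ^ 2
              nlinarith [sq_nonneg (2 * f o - b.1 o)]
        _ = 2 * ∫ o, f o ^ 2 ∂P0 + 2 * ∫ o, (f o - b.1 o) ^ 2 ∂P0 := by
            rw [integral_add hi1 hi2, integral_const_mul, integral_const_mul]
        _ ≤ _ := by nlinarith
    have hb1 := h1 f hf _ (Finset.mem_image_of_mem _ hb) hfb
    have hb2 := h2 b (Finset.mem_filter.2 ⟨hb, hl2⟩)
    have hb3 := htail_le _ hl n ω (fun hc => h3 b hb |>.1 hc)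
      ({o | Real.sqrt n * a < |b.1 o|}.indicator b.1) (fun o => by
        by_cases ho : Real.sqrt n * a < |b.1 o|
        · simp [ho]
        · simp [ho])
    have hb4 := htail_le _ (hu.sub hl) n ω (fun hc => h3 b hb |>.2 hc)
      ({o | Real.sqrt n * a < |(b.2 - b.1) o|}.indicator fun o => f o - b.1 o) (fun o => by
        by_cases ho : Real.sqrt n * a < |(b.2 - b.1) o|
        · rw [Set.indicator_of_mem (by exact ho), Set.indicator_of_mem (by exact ho), Pi.sub_apply,
            abs_of_nonneg (sub_nonneg.2 (hfb o).1), abs_of_nonneg (hB0 b hb o)]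
          linarith [(hfb o).2]
        · rw [Set.indicator_of_notMem (by exact ho), Set.indicator_of_notMem (by exact ho)]
          simp)
    have hsplit : f = fun o =>
        ({o | b.2 o - b.1 o ≤ truncLevel A n q}.indicator (fun o => f o - b.1 o) o +
          {o | |b.1 o| ≤ truncLevel A n q}.indicator b.1 o) +
        ({o | Real.sqrt n * a < |b.1 o|}.indicator b.1 o +
          {o | Real.sqrt n * a < |(b.2 - b.1) o|}.indicator (fun o => f o - b.1 o) o) := by
      funext o
      simp only [Set.indicator_apply, Set.mem_ofPred_eq, Pi.sub_apply, abs_of_nonneg (hB0 b hb o),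
        hτ]
      split_ifs <;> first | ring1 | (exfalso; linarith)
    have hm1 := memLp_indicator hfl (D := {o | b.2 o - b.1 o ≤ truncLevel A n q})
      (nullMeasurableSet_le (hu.sub hl).1.aemeasurable aemeasurable_const)
    have hm2 := memLp_indicator hl (D := {o | |b.1 o| ≤ truncLevel A n q})
      (nullMeasurableSet_le hl.norm.1.aemeasurable aemeasurable_const)
    have hm3 := memLp_indicator hl (D := {o | Real.sqrt n * a < |b.1 o|})
      (nullMeasurableSet_lt aemeasurable_const hl.norm.1.aemeasurable)
    have hm4 := memLp_indicator hfl (D := {o | Real.sqrt n * a < |(b.2 - b.1) o|})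
      (nullMeasurableSet_lt aemeasurable_const (hu.sub hl).norm.1.aemeasurable)
    have hi1 := hm1.integrable (by norm_num)
    have hi2 := hm2.integrable (by norm_num)
    have hi3 := hm3.integrable (by norm_num)
    have hi4 := hm4.integrable (by norm_num)
    have hi12 : Integrable (fun o =>
        {o | b.2 o - b.1 o ≤ truncLevel A n q}.indicator (fun o => f o - b.1 o) o +
          {o | |b.1 o| ≤ truncLevel A n q}.indicator b.1 o) P0 := hi1.add hi2
    have hi34 : Integrable (fun o => {o | Real.sqrt n * a < |b.1 o|}.indicator b.1 o +
        {o | Real.sqrt n * a < |(b.2 - b.1) o|}.indicator (fun o => f o - b.1 o) o) P0 :=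
      hi3.add hi4
    rw [hsplit, centredEmp_add hi12 hi34, centredEmp_add hi1 hi2,
      centredEmp_add hi3 hi4] at hlt
    have hdev : 3 * (2 * (1 / 16 : ℝ) ^ q) * (A * 8 ^ (q + 1)) = 48 * A * (1 / 2) ^ q := by
      have := pow_sixteenth_mul_pow_eight q
      calc _ = 6 * A * ((1 / 16 : ℝ) ^ q * 8 ^ (q + 1)) := by ring
        _ = _ := by rw [this]; ring
    rw [hdev] at hb2
    have ht := hlt.trans_le ((abs_add_le _ _).trans
      (add_le_add (abs_add_le _ _) (abs_add_le _ _)))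
    linarith
  · calc _ ≤ ENNReal.ofReal (6 * (1 / 2) ^ q) + η / 2 := by
          gcongr
          rw [← ENNReal.ofReal_ofNat, ← ENNReal.ofReal_mul (by norm_num),
            ← ENNReal.ofReal_add (by positivity) (by positivity)]
          refine ENNReal.ofReal_le_ofReal ?_
          have h1 := exp_neg_level_le hA (q + 1)
          have h2 : (0 : ℝ) < (1 / 2) ^ q := by positivity
          rw [pow_succ (1 / 2 : ℝ)] at h1
          linarith
      _ ≤ η / 2 + η / 2 := by gcongr
      _ = η := ENNReal.add_halves η

end Equicontinuity

/-! ### The unsolved direction -/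

namespace PCFit

variable {d k : ℕ} {F : PCFit d k} {𝒪 : Type*} {n : ℕ} {L : (Cube d → ℝ) → 𝒪 → ℝ}

lemma supported_fa (ℓ : Fin F.N → ℝ) : F.Supported (F.fa ℓ) := fun r hr => by
  simp [fa, a1, hr]

/-- `f_{a_n}` has Euclidean norm one, unless the constraint gradient vanishes. -/
lemma sum_fa_sq (ℓ : Fin F.N → ℝ) : ∑ r, F.fa ℓ r ^ 2 = 1 ∨ F.fa ℓ = 0 := by
  by_cases h0 : F.norm2 (F.a1 ℓ) = 0
  · right; funext r; simp [fa, h0]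
  · left
    simp only [fa, div_pow, ← Finset.sum_div, ← norm2_sq]
    exact div_self (pow_ne_zero 2 h0)

/-- Modulo tangent directions every supported direction `h` is a multiple `⟨h, f_{a_n}⟩` of
`f_{a_n}`, so that a single score, in the direction `ρ f_{a_n} - b` with `b` tangent, controls all
scores. -/
lemma SolvesTangentScores.abs_emp_score_le {o : Fin n → 𝒪} {ℓ : Fin F.N → ℝ}
    (hF : F.SolvesTangentScores L o ℓ) (hL : PathwiseDifferentiable L k) {b h : Fin F.p → ℝ}
    (hb : F.Tangent ℓ b) (hh : F.Supported h) {ρ c : ℝ} (hρ : 0 < ρ) (hc : F.norm2 h ≤ c * ρ) :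
    |emp o (score L F.θ (F.fn h))| ≤ c * |emp o (score L F.θ (F.fn (ρ • F.fa ℓ - b)))| := by
  simp only [← empScore_apply hL]
  set t := ∑ r, h r * F.fa ℓ r with ht
  have htan : F.Tangent ℓ (h - t • F.fa ℓ) := by
    refine ⟨fun r hr => by simp [hh r hr, supported_fa ℓ r hr], ?_⟩
    simp only [Pi.sub_apply, Pi.smul_apply, smul_eq_mul, sub_mul, Finset.sum_sub_distrib, ← ht,
      mul_assoc, ← Finset.mul_sum, ← sq]
    rcases sum_fa_sq ℓ with h1 | h1
    · rw [h1]; ring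
    · simp [ht, h1]
  have hEh : F.empScore hL o h = t * F.empScore hL o (F.fa ℓ) := by
    have h0 := hF _ htan
    rw [← empScore_apply hL, map_sub, map_smul, smul_eq_mul] at h0
    linarith
  have hEb : F.empScore hL o b = 0 := hF b hb
  have habs : |t| ≤ F.norm2 h := by
    refine Real.abs_le_sqrt ((Finset.sum_mul_sq_le_sq_mul_sq _ _ _).trans ?_)
    rcases sum_fa_sq ℓ with h1 | h1
    · rw [h1, mul_one]
    · simp only [h1, Pi.zero_apply]
      simpa using Finset.sum_nonneg fun r (_ : r ∈ Finset.univ) => sq_nonneg (h r)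
  rw [hEh, map_sub, map_smul, hEb, sub_zero, smul_eq_mul, abs_mul, abs_mul, abs_of_pos hρ,
    ← mul_assoc]
  exact mul_le_mul_of_nonneg_right (habs.trans hc) (abs_nonneg _)

lemma SolvesTangentScores.supScore_le {o : Fin n → 𝒪} {ℓ : Fin F.N → ℝ}
    (hF : F.SolvesTangentScores L o ℓ) (hL : PathwiseDifferentiable L k) {b : Fin F.p → ℝ}
    (hb : F.Tangent ℓ b) (M : ℝ) {ρ c r : ℝ} (hρ : 0 < ρ) (hr : r ≤ c * ρ) :
    F.supScore L o M r ≤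
      ENNReal.ofReal (c * |emp o (score L F.θ (F.fn (ρ • F.fa ℓ - b)))|) :=
  iSup₂_le fun _ hh => ENNReal.ofReal_le_ofReal
    (hF.abs_emp_score_le hL hb hh.1.1 hρ (hh.2.trans hr))

lemma supScore_of_nonpos (hL : PathwiseDifferentiable L k) (o : Fin n → 𝒪) (M : ℝ) {r : ℝ}
    (hr : r ≤ 0) : F.supScore L o M r = 0 := by
  refine le_antisymm (iSup₂_le fun h hh => ?_) zero_le
  have h0 : h = 0 := norm2_eq_zero (le_antisymm (hh.2.trans hr) (Real.sqrt_nonneg _))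
  rw [← empScore_apply hL, h0, map_zero, abs_zero, ENNReal.ofReal_zero]

end PCFit

/-! ### Negligibility of the empirical scores -/

section Negligible

variable {Ω 𝒪 : Type*} [MeasurableSpace Ω] {P : Measure Ω}

lemma LittleOP.mono {Z Z' : ℕ → Ω → ℝ≥0∞} {r : ℕ → ℝ} (h : LittleOP P Z r)
    (hle : ∀ᶠ n in atTop, ∀ ω, Z' n ω ≤ Z n ω) : LittleOP P Z' r := fun ε hε => by
  refine tendsto_of_tendsto_of_tendsto_of_le_of_le' tendsto_const_nhds (h ε hε)
    (Eventually.of_forall fun _ => zero_le) ?_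
  filter_upwards [hle] with n hn
  refine measure_mono fun ω hω => ?_
  simp only [Set.mem_ofPred_eq] at hω ⊢
  exact hω.trans_le (hn ω)

/-- A scale larger by the factor `√(n / J_n) = O_P(1)` does not change the order. -/
lemma LittleOP.of_sqrt_ratio {Z Z' : ℕ → Ω → ℝ≥0∞} {r : ℕ → ℝ} {J : ℕ → Ω → ℕ}
    (hZ : LittleOP P Z r) (hJ : BigOPOne P (fun n ω => (n : ℝ≥0∞) / (J n ω : ℝ≥0∞)))
    (hle : ∀ᶠ n in atTop, ∀ ω, 0 < J n ω →
      Z' n ω ≤ ENNReal.ofReal (Real.sqrt ((n : ℝ) / J n ω)) * Z n ω)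
    (hzero : ∀ n ω, J n ω = 0 → Z' n ω = 0) : LittleOP P Z' r := by
  intro ε hε
  rw [ENNReal.tendsto_nhds_zero]
  intro η hη
  have hη2 : 0 < η / 2 := ENNReal.div_pos hη.ne' (by norm_num)
  obtain ⟨B, hB⟩ := hJ (η / 2) hη2
  set C : ℝ := Real.sqrt B + 1 with hC
  have hC0 : 0 < C := by positivity
  filter_upwards [hB, (hZ (ε / C) (by positivity)).eventually_le_const hη2, hle] with n h1 h2 h3
  calc _ ≤ η / 2 + η / 2 := by
        refine (measure_mono (t := _ ∪ _) ?_).trans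
          ((measure_union_le _ _).trans (add_le_add h1 h2))
        intro ω hω
        by_contra hc
        simp only [Set.mem_union, Set.mem_ofPred_eq, not_or, not_lt] at hω hc
        obtain ⟨c1, c2⟩ := hc
        rcases Nat.eq_zero_or_pos (J n ω) with h0 | h0
        · rw [hzero n ω h0] at hω
          exact not_lt_zero hω
        · have hJ0 : (0 : ℝ) < J n ω := by exact_mod_cast h0
          have hratio : (n : ℝ) / J n ω ≤ B := by
            rw [ENNReal.div_le_iff (by exact_mod_cast h0.ne') (by simp)] at c1
            rw [div_le_iff₀ hJ0]
            exact_mod_cast c1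
          have h4 := h3 ω h0
          have h5 : ENNReal.ofReal (Real.sqrt ((n : ℝ) / J n ω)) * Z n ω ≤
              ENNReal.ofReal C * ENNReal.ofReal (ε / C * r n) := by
            refine mul_le_mul' (ENNReal.ofReal_le_ofReal ?_) c2
            exact (Real.sqrt_le_sqrt hratio).trans (by rw [hC]; linarith)
          rw [← ENNReal.ofReal_mul hC0.le, ← mul_assoc, mul_div_cancel₀ _ hC0.ne'] at h5
          exact absurd (h4.trans h5) (not_le.2 hω)
    _ = η := ENNReal.add_halves η

variable [MeasurableSpace 𝒪] {P0 : Measure 𝒪} [IsProbabilityMeasure P] [IsProbabilityMeasure P0]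
  {O : ℕ → Ω → 𝒪} {d k : ℕ} {L : (Cube d → ℝ) → 𝒪 → ℝ} {ψ₀ : Cube d → ℝ}
  {fit : ∀ n : ℕ, (Fin n → 𝒪) → PCFit d k}

/-- The empirical score in a data-dependent direction `D_n` with bounded `‖β(D_n)‖₁` is
`o_P(n^{-1/2})`: its centred part by equicontinuity of the empirical process over the score class,
after rescaling `D_n` into the ball of radius `M`; its mean because the population score vanishes at
`ψ₀`. -/
theorem littleOP_emp_score (h : IsIIDSample P P0 O) (hLint : ∀ ψ ∈ D0 d, Integrable (L ψ) P0)
    (hL : PathwiseDifferentiable L k) (hψ₀ : IsRiskMinimizer L P0 ψ₀)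
    (hrisk : RiskDifferentiableAt L P0 k ψ₀) {M : ℝ} (hM : 0 < M)
    (hα : Tendsto (fun n => P {ω | M < (fit n (sample O n ω)).svn (fit n (sample O n ω)).α})
      atTop (𝓝 0))
    (hent : EntropyBound P0 k (scoreClass L fit M))
    (D : ∀ (n : ℕ) (o : Fin n → 𝒪), Fin (fit n o).p → ℝ)
    (hsupp : ∀ n o, 1 ≤ n → (fit n o).Supported (D n o))
    (hbdd : BigOPOne P (fun n ω => ENNReal.ofReal
      ((fit n (sample O n ω)).svn (D n (sample O n ω)))))
    (hnorm : LittleOP P (fun n ω => eLpNorm (score L (fit n (sample O n ω)).θ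
      ((fit n (sample O n ω)).fn (D n (sample O n ω)))) 2 P0) (fun _ => 1))
    (Z : ℕ → Ω → ℝ≥0∞) (hZ : LittleOP P Z (fun n => 1 / Real.sqrt n)) (K : ℝ≥0)
    (hbias : ∀ n ω, (fit n (sample O n ω)).svn (fit n (sample O n ω)).α ≤ M →
      ENNReal.ofReal |(∫ z, score L (fit n (sample O n ω)).θ
          ((fit n (sample O n ω)).fn (D n (sample O n ω))) z ∂P0) -
        ∫ z, score L ψ₀ ((fit n (sample O n ω)).fn (D n (sample O n ω))) z ∂P0| ≤ K * Z n ω) :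
    LittleOP P (fun n ω => ENNReal.ofReal |emp (sample O n ω) (score L (fit n (sample O n ω)).θ
      ((fit n (sample O n ω)).fn (D n (sample O n ω))))|) (fun n => 1 / Real.sqrt n) := by
  intro ε hε
  obtain ⟨A, hA, hB⟩ := hent.hasBrackets
  have hmem : ∀ f ∈ scoreClass L fit M, MemLp f 2 P0 := by
    rintro f hf
    refine hB.memLp hf ?_
    obtain ⟨n, o, t, v, -, -, -, rfl⟩ := hf
    exact aestronglyMeasurable_score hLint hL ((fit n o).fn_mem t) ((fit n o).fn_mem v)
  rw [ENNReal.tendsto_nhds_zero]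
  intro η hη
  have hη5 : 0 < η / 5 := ENNReal.div_pos hη.ne' (by norm_num)
  obtain ⟨B, hBev⟩ := hbdd (η / 5) hη5
  set R : ℝ := max B M with hR
  have hR0 : 0 < R := hM.trans_le (le_max_right _ _)
  set s : ℝ := M / R with hs
  have hs0 : 0 < s := by positivity
  have hs1 : s ≤ 1 := (div_le_one hR0).2 (le_max_right _ _)
  obtain ⟨δ, hδ, hGev⟩ := h.equicontinuous hA hmem hB (x := s * (ε / 2)) (by positivity) hη5
  set ε' : ℝ := ε / (2 * (K + 1)) with hε'
  have hε'0 : 0 < ε' := by positivity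
  have hKε : K * ε' ≤ ε / 2 := by
    rw [hε', mul_div_assoc', div_le_div_iff₀ (by positivity) (by norm_num)]
    nlinarith [K.coe_nonneg]
  filter_upwards [eventually_ge_atTop 1, hα.eventually_le_const hη5, hBev, hGev,
    (hnorm δ hδ).eventually_le_const hη5, (hZ ε' hε'0).eventually_le_const hη5]
    with n hn h1 h2 h3 h4 h5
  have hsqrt : 0 < Real.sqrt n := Real.sqrt_pos.2 (by exact_mod_cast hn)
  calc _ ≤ η / 5 + (η / 5 + (η / 5 + (η / 5 + η / 5))) := by
        refine (measure_mono (t := _ ∪ (_ ∪ (_ ∪ (_ ∪ _)))) ?_).trans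
          ((measure_union_le _ _).trans (add_le_add h1 ((measure_union_le _ _).trans
            (add_le_add h2 ((measure_union_le _ _).trans (add_le_add h3
              ((measure_union_le _ _).trans (add_le_add h4 h5))))))))
        intro ω hω
        by_contra hc
        simp only [Set.mem_union, Set.mem_ofPred_eq, not_or, not_exists, not_and, not_lt] at hω hc
        obtain ⟨c1, c2, c3, c4, c5⟩ := hc
        set o := sample O n ω with ho
        set F := fit n o with hF
        have hD : F.svn (D n o) ≤ R := by
          rw [← ENNReal.ofReal_coe_nnreal] at c2
          exact ((ENNReal.ofReal_le_ofReal_iff B.coe_nonneg).1 c2).trans (le_max_left _ _)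
        have hSm : AEStronglyMeasurable (score L F.θ (F.fn (D n o))) P0 :=
          aestronglyMeasurable_score hLint hL (F.fn_mem _) (F.fn_mem _)
        have hS : MemLp (score L F.θ (F.fn (D n o))) 2 P0 :=
          ⟨hSm, c4.trans_lt ENNReal.ofReal_lt_top⟩
        have hS2 : ∫ z, score L F.θ (F.fn (D n o)) z ^ 2 ∂P0 ≤ δ ^ 2 :=
          integral_sq_le_of_eLpNorm_le hS hδ.le (by simpa using c4)
        have hscale : score L F.θ (F.fn (s • D n o)) =
            fun z => s * score L F.θ (F.fn (D n o)) z := by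
          funext z; rw [PCFit.fn_smul, score_smul]
        have hclass : score L F.θ (F.fn (s • D n o)) ∈ scoreClass L fit M := by
          refine ⟨n, o, F.α, s • D n o, hn, ⟨fun r hr => ?_, c1⟩, ⟨fun r hr => ?_, ?_⟩, rfl⟩
          · simpa [PCFit.active] using hr
          · simp [hsupp n o hn r hr]
          · rw [PCFit.svn_smul, abs_of_pos hs0, hs, div_mul_eq_mul_div, div_le_iff₀ hR0]
            exact mul_le_mul_of_nonneg_left hD hM.le
        have hcent := c3 _ hclass (by
          rw [hscale]
          simp only [mul_pow, integral_const_mul]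
          have h0 : 0 ≤ ∫ z, score L F.θ (F.fn (D n o)) z ^ 2 ∂P0 :=
            integral_nonneg fun z => sq_nonneg _
          nlinarith [pow_le_one₀ hs0.le hs1 (n := 2)])
        have hG : |Real.sqrt n * (emp o (score L F.θ (F.fn (D n o))) -
            ∫ z, score L F.θ (F.fn (D n o)) z ∂P0)| ≤ ε / 2 := by
          rw [hscale, centredEmp, emp_mul, integral_const_mul, ← mul_sub, mul_left_comm, abs_mul,
            abs_of_pos hs0] at hcent
          exact le_of_mul_le_mul_left hcent hs0
        have hmean : |∫ z, score L F.θ (F.fn (D n o)) z ∂P0| ≤ ε / 2 * (1 / Real.sqrt n) := by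
          have hb := hbias n ω c1
          rw [integral_score_eq_zero hψ₀ hrisk (F.fn_mem _), sub_zero] at hb
          have hb' := hb.trans (mul_le_mul_right c5 _)
          rw [← ENNReal.ofReal_coe_nnreal, ← ENNReal.ofReal_mul K.coe_nonneg,
            ENNReal.ofReal_le_ofReal_iff (by positivity), ← mul_assoc] at hb'
          exact hb'.trans (mul_le_mul_of_nonneg_right hKε (by positivity))
        rw [abs_mul, abs_of_pos hsqrt, mul_comm, ← le_div_iff₀ hsqrt] at hG
        have hlt := (ENNReal.ofReal_lt_ofReal_iff_of_nonneg (by positivity)).1 hω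
        have htri := abs_add_le (emp o (score L F.θ (F.fn (D n o))) -
            ∫ z, score L F.θ (F.fn (D n o)) z ∂P0) (∫ z, score L F.θ (F.fn (D n o)) z ∂P0)
        rw [sub_add_cancel] at htri
        have he : ε * (1 / Real.sqrt n) = ε / 2 / Real.sqrt n + ε / 2 * (1 / Real.sqrt n) := by
          ring
        linarith
    _ = η := by
        rw [show η / 5 + (η / 5 + (η / 5 + (η / 5 + η / 5))) = 5 * (η / 5) by ring]
        exact ENNReal.mul_div_cancel (by norm_num) (by norm_num)

/-- Under the projection condition the score in the unsolved direction, corrected by its projection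
on the tangent subspace, is `o_P(n^{-1/2})`. -/
theorem ProjectionCondition.littleOP_emp_score (h : IsIIDSample P P0 O) {X : 𝒪 → Cube d}
    (hLint : ∀ ψ ∈ D0 d, Integrable (L ψ) P0)
    (hL : PathwiseDifferentiable L k) (hψ₀ : IsRiskMinimizer L P0 ψ₀)
    (hrisk : RiskDifferentiableAt L P0 k ψ₀) {M : ℝ} (hM : 0 < M)
    (hα : Tendsto (fun n => P {ω | M < (fit n (sample O n ω)).svn (fit n (sample O n ω)).α})
      atTop (𝓝 0))
    (hent : EntropyBound P0 k (scoreClass L fit M))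
    {ℓ : ∀ (n : ℕ) (o : Fin n → 𝒪), Fin (fit n o).N → ℝ} {ρ : ∀ n : ℕ, (Fin n → 𝒪) → ℝ}
    (hproj : ProjectionCondition P P0 O X L ψ₀ M fit ℓ ρ) :
    ∃ b : ∀ (n : ℕ) (o : Fin n → 𝒪), Fin (fit n o).p → ℝ,
      (∀ n o, 1 ≤ n → (fit n o).Tangent (ℓ n o) (b n o)) ∧
      LittleOP P (fun n ω => ENNReal.ofReal |emp (sample O n ω) (score L (fit n (sample O n ω)).θ
        ((fit n (sample O n ω)).fn (ρ n (sample O n ω) •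
          (fit n (sample O n ω)).fa (ℓ n (sample O n ω)) - b n (sample O n ω))))|)
        (fun n => 1 / Real.sqrt n) := by
  obtain ⟨b, hb, hbdd, hnorm, hcase⟩ := hproj
  have hsupp : ∀ n o, 1 ≤ n → (fit n o).Supported (ρ n o • (fit n o).fa (ℓ n o) - b n o) :=
    fun n o hn r hr => by
      simp [PCFit.supported_fa (ℓ n o) r hr, (hb n o hn).1.1 r hr]
  refine ⟨b, fun n o hn => (hb n o hn).1, ?_⟩
  rcases hcase with ⟨⟨K, hK⟩, hZ⟩ | ⟨⟨K, hK⟩, hZ⟩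
  all_goals
    refine PCHA.littleOP_emp_score h hLint hL hψ₀ hrisk hM hα hent
      (fun n o => ρ n o • (fit n o).fa (ℓ n o) - b n o) hsupp hbdd hnorm _ hZ K fun n ω hω => ?_
    rw [← mul_assoc]
    exact hK _ (PCFit.fn_mem_splineBall hω) _ (PCFit.fn_mem _ _)

end Negligible

end PCHA

end

theorem theorem3 {Ω 𝒪 : Type*} [MeasurableSpace Ω] [MeasurableSpace 𝒪]
    (P : Measure Ω) [IsProbabilityMeasure P] (P0 : Measure 𝒪) [IsProbabilityMeasure P0]
    (O : ℕ → Ω → 𝒪) (hO : ∀ i, Measurable (O i)) (hlaw : ∀ i, P.map (O i) = P0)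
    (hindep : iIndepFun O P)
    (d k : ℕ) (X : 𝒪 → PCHA.Cube d) (hX : Measurable X)
    (L : (PCHA.Cube d → ℝ) → 𝒪 → ℝ) (hLint : ∀ ψ ∈ PCHA.D0 d, Integrable (L ψ) P0)
    (hLdiff : PCHA.PathwiseDifferentiable L k)
    (ψ₀ : PCHA.Cube d → ℝ) (hψ₀ : PCHA.IsRiskMinimizer L P0 ψ₀)
    (hrisk : PCHA.RiskDifferentiableAt L P0 k ψ₀)
    (fit : ∀ n : ℕ, (Fin n → 𝒪) → PCHA.PCFit d k)
    (hfit : ∀ (n : ℕ) (o : Fin n → 𝒪), 1 ≤ n → (fit n o).IsPCHAGL L o) :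
    -- the constraint gradient can be formed with a subgradient of the `L₁` norm at `β(α_n)` for
    -- which all tangent score equations are solved exactly
    (∀ (n : ℕ) (o : Fin n → 𝒪), 1 ≤ n → ∃ ℓ : Fin (fit n o).N → ℝ,
      (fit n o).IsSubgradient ℓ ∧ (fit n o).SolvesTangentScores L o ℓ) ∧
    -- if no coordinate of `β(α_n)` vanishes, it is the sign vector
    (∀ (n : ℕ) (o : Fin n → 𝒪), 1 ≤ n → (∀ j, (fit n o).β (fit n o).α j ≠ 0) →
      (fit n o).SolvesTangentScores L o (fun j => Real.sign ((fit n o).β (fit n o).α j))) ∧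
    -- uniform negligibility of the empirical score
    (∀ M : ℝ, 0 < M →
      Tendsto (fun n => P {ω | M < (fit n (PCHA.sample O n ω)).svn (fit n (PCHA.sample O n ω)).α})
        atTop (𝓝 0) →
      PCHA.EntropyBound P0 k (PCHA.scoreClass L fit M) →
      ∀ ℓ : ∀ (n : ℕ) (o : Fin n → 𝒪), Fin (fit n o).N → ℝ,
        (∀ (n : ℕ) (o : Fin n → 𝒪), 1 ≤ n →
          (fit n o).IsSubgradient (ℓ n o) ∧ (fit n o).SolvesTangentScores L o (ℓ n o)) →
        -- unsolved direction scaled to norm `J_n^{-1/2}`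
        (PCHA.ProjectionCondition P P0 O X L ψ₀ M fit ℓ
            (fun n o => 1 / Real.sqrt ((fit n o).J : ℝ)) →
          PCHA.LittleOP P (fun n ω => (fit n (PCHA.sample O n ω)).supScore L (PCHA.sample O n ω) M
            (1 / Real.sqrt ((fit n (PCHA.sample O n ω)).J : ℝ))) (fun n => 1 / Real.sqrt n)) ∧
        -- unsolved direction scaled to norm `n^{-1/2}`
        (PCHA.ProjectionCondition P P0 O X L ψ₀ M fit ℓ (fun n _ => 1 / Real.sqrt (n : ℝ)) →
          PCHA.LittleOP P (fun n ω => (fit n (PCHA.sample O n ω)).supScore L (PCHA.sample O n ω) M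
            (1 / Real.sqrt (n : ℝ))) (fun n => 1 / Real.sqrt n) ∧
          (PCHA.BigOPOne P (fun n ω => (n : ℝ≥0∞) / ((fit n (PCHA.sample O n ω)).J : ℝ≥0∞)) →
            PCHA.LittleOP P (fun n ω => (fit n (PCHA.sample O n ω)).supScore L
              (PCHA.sample O n ω) M (1 / Real.sqrt ((fit n (PCHA.sample O n ω)).J : ℝ)))
              (fun n => 1 / Real.sqrt n)))) := by
  have h : PCHA.IsIIDSample P P0 O := ⟨hO, hlaw, hindep⟩
  refine ⟨fun n o hn => (hfit n o hn).exists_subgradient_solvesTangentScores hLdiff,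
    fun n o hn hβ => (hfit n o hn).solvesTangentScores_sign hLdiff hβ, ?_⟩
  intro M hM hα hent ℓ hℓ
  refine ⟨fun hproj => ?_, fun hproj => ?_⟩
  · obtain ⟨b, hb, hE⟩ := hproj.littleOP_emp_score h hLint hLdiff hψ₀ hrisk hM hα hent
    refine hE.mono ?_
    filter_upwards [eventually_ge_atTop 1] with n hn ω
    set o := PCHA.sample O n ω
    rcases Nat.eq_zero_or_pos (fit n o).J with h0 | h0
    · rw [PCHA.PCFit.supScore_of_nonpos hLdiff o M (by simp [h0])]
      exact zero_le
    · have hρ : 0 < 1 / Real.sqrt ((fit n o).J : ℝ) := by positivity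
      simpa using (hℓ n o hn).2.supScore_le hLdiff (hb n o hn) M hρ (c := 1) (one_mul _).ge
  · obtain ⟨b, hb, hE⟩ := hproj.littleOP_emp_score h hLint hLdiff hψ₀ hrisk hM hα hent
    refine ⟨hE.mono ?_, fun hJ => hE.of_sqrt_ratio hJ ?_ fun n ω h0 => ?_⟩
    · filter_upwards [eventually_ge_atTop 1] with n hn ω
      have hρ : 0 < 1 / Real.sqrt (n : ℝ) := by positivity
      simpa using (hℓ n _ hn).2.supScore_le hLdiff (hb n _ hn) M hρ (c := 1) (one_mul _).ge
    · filter_upwards [eventually_ge_atTop 1] with n hn ω h0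
      have hρ : 0 < 1 / Real.sqrt (n : ℝ) := by positivity
      have hs : Real.sqrt (n : ℝ) ≠ 0 := by positivity
      rw [← ENNReal.ofReal_mul (Real.sqrt_nonneg _)]
      refine (hℓ n _ hn).2.supScore_le hLdiff (hb n _ hn) M hρ (le_of_eq ?_)
      rw [Real.sqrt_div' _ (Nat.cast_nonneg _)]
      field_simp
    · exact PCHA.PCFit.supScore_of_nonpos hLdiff _ M (by simp [h0])
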